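/- Let $p$ be a prime, $q=p^u$ and $Q=p^s$ with integers $u,s\ge 1$, and let $f\in\mathbb F_Q[x]$ have degree $d$ with $\gcd(d,p)=1$. Let $X$ be the smooth projective curve over $\mathbb F_Q$ defined by the affine equation $y^{q}-y=f(x)$ (a generalized Artin–Schreier curve); its genus is $g=(q-1)(d-1)/2$. Let $$L_X(T)=\exp\Big(\sum_{i\ge 1}\big(\#X(\mathbb F_{Q^i})-Q^i-1\big)\frac{T^i}{i}\Big)=\sum_{i=0}^{2g}c_iT^i,\qquad c_i\in\mathbb Z,$$ be its $L$-polynomial. Let the Newton polygon of $X/\mathbb F_Q$ be the lower convex hull of the points $(i,\operatorname{ord}_p(c_i)/s)$, $0\le i\le 2g$ (where $\operatorname{ord}_p(0)=\infty$), which starts at $(0,0)$, and suppose that its first slope is $1/\sigma$, where $\sigma\ge 2$ is a real number. Then: 1. $p^{\lceil si/\sigma\rceil}$ divides $c_i$ for $1\le i\le 2g$; 2. $p^{\lceil sn/\sigma\rceil}$ divides $|\#X(\mathbb F_{Q^n})-(Q^n+1)|$ for all integers $n\ge 1$. -/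

import Mathlib

open Polynomial

noncomputable section

/-- `F` is the function field, over `k`, of the (generalized Artin-Schreier) curve
`y ^ q - y = f(x)`: it is generated over `k` by a transcendental element `x` and an element `y`
satisfying the equation. -/
structure IsFunctionFieldOf (k F : Type*) [Field k] [Field F] [Algebra k F]
    (q : ℕ) (f : k[X]) (x y : F) : Prop where
  transcendental : Transcendental k x
  equation : y ^ q - y = aeval x f
  adjoin_eq_top : IntermediateField.adjoin k {x, y} = ⊤

/-- The `K`-rational points of the smooth projective curve over `k` whose function field is `F`.
The points of this curve are the valuation rings of `F` that contain `k` (the local rings of the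
curve), and a morphism `Spec K → X` of `k`-schemes is a point of `X` together with a local
homomorphism of `k`-algebras from its local ring to `K`, namely the evaluation at the point of the
functions regular there. -/
structure CurvePoint (k F K : Type*) [Field k] [Field F] [Algebra k F] [Field K]
    [Algebra k K] where
  /-- the local ring of the curve at the point -/
  localRing : ValuationSubring F
  algebraMap_mem : ∀ a : k, algebraMap k F a ∈ localRing
  /-- evaluation of functions at the point -/
  eval : localRing →+* K
  isLocalHom_eval : IsLocalHom eval
  eval_algebraMap : ∀ a : k, eval ⟨algebraMap k F a, algebraMap_mem a⟩ = algebraMap k K a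

/-- `#X(𝔽_{Q ^ n})`, where `k` is the field with `Q` elements, `X` is the smooth projective curve
over `k` with function field `F`, and `𝔽_{Q ^ n}` is the extension of `k` of degree `n`. -/
def numPoints (k F : Type*) [Field k] [Finite k] [Field F] [Algebra k F]
    (p : ℕ) [Fact p.Prime] [CharP k p] (n : ℕ) [NeZero n] : ℕ :=
  Nat.card (CurvePoint k F (FiniteField.Extension k p n))

/-- The power series `∑_{i ≥ 1} (#X(𝔽_{Q ^ i}) - Q ^ i - 1) T ^ i / i`. -/
def logLSeries (k F : Type*) [Field k] [Finite k] [Field F] [Algebra k F]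
    (p : ℕ) [Fact p.Prime] [CharP k p] : PowerSeries ℚ :=
  PowerSeries.mk fun i => match i with
    | 0 => 0
    | j + 1 => ((numPoints k F p (j + 1) : ℚ) - (Nat.card k : ℚ) ^ (j + 1) - 1) / ((j + 1 : ℕ) : ℚ)

/-- `L_X(T) = exp (∑_{i ≥ 1} (#X(𝔽_{Q ^ i}) - Q ^ i - 1) T ^ i / i)`, as a formal power series. -/
def curveLSeries (k F : Type*) [Field k] [Finite k] [Field F] [Algebra k F]
    (p : ℕ) [Fact p.Prime] [CharP k p] : PowerSeries ℚ :=
  (PowerSeries.exp ℚ).subst (logLSeries k F p)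

/-- The genus `(q - 1) (d - 1) / 2` of the curve `y ^ q - y = f(x)` with `deg f = d` prime to `q`
(the product is even). -/
def artinSchreierGenus (q d : ℕ) : ℕ := (q - 1) * (d - 1) / 2

/-- The points `(i, ord_p (c_i) / s)` for `0 ≤ i ≤ N`; an index with `c_i = 0` (that is,
`ord_p (c_i) = ∞`) contributes no point. -/
def newtonPoints (p s N : ℕ) (c : ℕ → ℚ) : Set (ℝ × ℝ) :=
  {P | ∃ i : ℕ, i ≤ N ∧ c i ≠ 0 ∧ P = ((i : ℝ), (padicValRat p (c i) : ℝ) / (s : ℝ))}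

/-- The normalized `p`-adic Newton polygon of `∑_{i ≤ N} c_i T ^ i`: the lower boundary of the
convex hull of the points `(i, ord_p (c_i) / s)`. -/
def newtonPolygon (p s N : ℕ) (c : ℕ → ℚ) : Set (ℝ × ℝ) :=
  {P | P ∈ convexHull ℝ (newtonPoints p s N c) ∧
    ∀ z : ℝ, (P.1, z) ∈ convexHull ℝ (newtonPoints p s N c) → P.2 ≤ z}

/-- A polygon with initial point `(0, 0)` has first slope `m`: it begins with a nondegenerate
segment of slope `m`. -/
def HasFirstSlope (NP : Set (ℝ × ℝ)) (m : ℝ) : Prop :=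
  ∃ ε : ℝ, 0 < ε ∧ ∀ t ∈ Set.Icc (0 : ℝ) ε, (t, m * t) ∈ NP

end

/-! Write q = p ^ u and S_j = #X(𝔽_{Q^j}) - Q^j - 1. Suppose L_X is known to be an integral
polynomial of degree at most 2g. A point (i, ord_p(c_i)/s) below the line of slope 1/σ through the
origin would pull the convex hull below its first edge, so ord_p(c_i) ≥ si/σ
(`mul_le_of_hasFirstSlope`). This is part 1. Part 2 follows by induction from n c_n = ∑_{1 ≤ j ≤ n}
c_{n-j} S_j: since c_0 = 1, S_n is n c_n minus products c_{n-j} S_j with j < n, and the exponents of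
p in such a product add up to at least ⌈sn/σ⌉.

Integrality and the degree bound are proved by exponential sums. The curve has one rational place at
infinity, because the values of x^e y^i with i < q are pairwise distinct there, and its affine model
is smooth, so X(𝔽_{Q^n}) consists of one point and the solutions of the equation
(`natCard_curvePoint`). Detecting the values of b ↦ b^q - b by additive characters turns S_n into a
sum, over the nonzero c in 𝔽_q ∩ 𝔽_{Q^n}, of the exponential sums of c f
(`numPoints_sub_eq_sum_exponentialSum`).

The L-function of one such family is ∑_n T^n ∑_h χ(h), where h runs over the monic polynomials of
degree n and χ(h) is the additive character of the sum of the values at the roots of h. For n ≥ d,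
adding t X^(n-d) to h multiplies χ(h) by a constant that is not 1 for suitable t, so the inner sum
vanishes (`sum_stable_eq_zero`). The L-function is thus a polynomial of degree at most d - 1 whose
coefficients are sums of roots of unity (`exists_exponentialSum_lPolynomial`). Multiplying L_r(T^m)
over the Frobenius orbits of 𝔽_q \ {0}, with m the length of the orbit of r, gives L_X, of degree at
most (q - 1)(d - 1) = 2g. Its coefficients are rational algebraic integers, hence integers. -/

/-! ### Stable multisets of an injective map, and the Euler product recursion. -/

section OrbitMultiset

variable {α : Type*} {F : α → α}

/-- The multiset `{a, F a, …, F ^ (j - 1) a}`. -/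
def orbitMultiset (F : α → α) (a : α) (j : ℕ) : Multiset α :=
  (Multiset.range j).map fun i => F^[i] a

theorem card_orbitMultiset (a : α) (j : ℕ) : (orbitMultiset F a j).card = j := by
  simp [orbitMultiset]

theorem map_orbitMultiset {a : α} {j : ℕ} (h : F^[j] a = a) :
    (orbitMultiset F a j).map F = orbitMultiset F a j := by
  have e : (orbitMultiset F a j).map F + {a} = orbitMultiset F a j + {a} := by
    have h1 : orbitMultiset F a (j + 1) = orbitMultiset F a j + {a} := by
      simp [orbitMultiset, Multiset.range_succ, h, add_comm]
    have h2 : orbitMultiset F a (j + 1) = (orbitMultiset F a j).map F + {a} := by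
      have := List.range_succ_eq_map (n := j)
      simp only [orbitMultiset, ← Multiset.coe_range, this, Multiset.map_coe, List.map_cons,
        List.map_map, Function.comp_def, Function.iterate_succ_apply', Function.iterate_zero, id]
      simp [← Multiset.cons_coe, add_comm]
    rw [← h1, ← h2]
  exact add_right_cancel e

variable [DecidableEq α]

theorem count_iterate_of_map_eq (hF : F.Injective) {M : Multiset α} (hM : M.map F = M) (a : α)
    (i : ℕ) : M.count (F^[i] a) = M.count a := by
  induction i with
  | zero => rfl
  | succ i ih =>
    rw [Function.iterate_succ_apply', ← ih]
    conv_lhs => rw [← hM]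
    exact Multiset.count_map_eq_count' F M hF _

/-- The sequence runs `j / m` times around the cycle of `a`, with `m` the minimal period. If `m =
0`, then `j = 0` and both sides vanish. -/
theorem count_orbitMultiset_self {a : α} {j : ℕ} (h : F^[j] a = a) :
    (orbitMultiset F a j).count a = j / Function.minimalPeriod F a := by
  have hd : Function.minimalPeriod F a ∣ j := Function.IsPeriodicPt.minimalPeriod_dvd h
  obtain ⟨k, rfl⟩ := hd
  rcases Nat.eq_zero_or_pos (Function.minimalPeriod F a) with h0 | h0
  · simp [h0, orbitMultiset]
  rw [Nat.mul_div_cancel_left _ h0]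
  have : (orbitMultiset F a (Function.minimalPeriod F a * k)).count a =
      ((Finset.range (Function.minimalPeriod F a * k)).filter
        fun i => Function.minimalPeriod F a ∣ i).card := by
    rw [orbitMultiset, Multiset.count_map, Finset.card_def, Finset.filter_val, Finset.range_val]
    congr 1
    refine Multiset.filter_congr fun i _ => ?_
    rw [eq_comm]
    exact Function.isPeriodicPt_iff_minimalPeriod_dvd
  rw [this]
  have : (Finset.range (Function.minimalPeriod F a * k)).filter
      (fun i => Function.minimalPeriod F a ∣ i) =
      (Finset.range k).image (Function.minimalPeriod F a * ·) := by
    ext i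
    simp only [Finset.mem_filter, Finset.mem_range, Finset.mem_image]
    constructor
    · rintro ⟨hi, l, rfl⟩
      exact ⟨l, lt_of_mul_lt_mul_left hi (Nat.zero_le _), rfl⟩
    · rintro ⟨l, hl, rfl⟩
      exact ⟨Nat.mul_lt_mul_of_pos_left hl h0, dvd_mul_right _ _⟩
  rw [this, Finset.card_image_of_injective _ (mul_right_injective₀ h0.ne'), Finset.card_range]

theorem orbitMultiset_le_iff (hF : F.Injective) {M : Multiset α} (hM : M.map F = M) {a : α}
    {j : ℕ} (h : F^[j] a = a) :
    orbitMultiset F a j ≤ M ↔ j / Function.minimalPeriod F a ≤ M.count a := by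
  rw [← count_orbitMultiset_self h, Multiset.le_iff_count]
  refine ⟨fun h => h a, fun hc b => ?_⟩
  by_cases hb : b ∈ orbitMultiset F a j
  · obtain ⟨i, -, rfl⟩ := Multiset.mem_map.1 hb
    rwa [count_iterate_of_map_eq hF hM, count_iterate_of_map_eq hF (map_orbitMultiset h)]
  · simp [Multiset.count_eq_zero_of_notMem hb]

theorem minimalPeriod_pos_of_mem (hF : F.Injective) {M : Multiset α} (hM : M.map F = M) {a : α}
    (ha : a ∈ M) : 0 < Function.minimalPeriod F a := by
  have h1 : ∀ i, F^[i] a ∈ M.toFinset := fun i => by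
    rw [Multiset.mem_toFinset, ← Multiset.count_pos, count_iterate_of_map_eq hF hM,
      Multiset.count_pos]
    exact ha
  obtain ⟨i, j, hij, h⟩ := Finite.exists_ne_map_eq_of_infinite
    (fun i : ℕ => (⟨F^[i] a, h1 i⟩ : M.toFinset))
  simp only [Subtype.mk.injEq] at h
  wlog hlt : i < j generalizing i j
  · exact this j i hij.symm h.symm (by omega)
  refine Function.minimalPeriod_pos_of_mem_periodicPts ⟨j - i, by omega, ?_⟩
  apply hF.iterate i
  rw [← Function.iterate_add_apply, h]
  congr 1
  omega

/-- An orbit multiset starting at `a` fits into `M` exactly when its length is `k` times the period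
of `a` with `k` at most the multiplicity of `a`. So each `a` accounts for as many pairs as its
multiplicity in `M`. -/
theorem card_filter_orbitMultiset_le (hF : F.Injective) {P : ℕ → Finset α}
    (hP : ∀ j, j ≠ 0 → ∀ a, a ∈ P j ↔ F^[j] a = a) {M : Multiset α} (hM : M.map F = M) :
    (((Finset.Icc 1 M.card).sigma P).filter
      fun x => orbitMultiset F x.2 x.1 ≤ M).card = M.card := by
  have : ((Finset.Icc 1 M.card).sigma P).filter (fun x => orbitMultiset F x.2 x.1 ≤ M) =
      (M.toFinset.sigma fun a => Finset.Icc 1 (M.count a)).image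
        fun y => (⟨y.2 * Function.minimalPeriod F y.1, y.1⟩ : Σ _ : ℕ, α) := by
    ext ⟨j, a⟩
    simp only [Finset.mem_filter, Finset.mem_sigma, Finset.mem_Icc, Finset.mem_image,
      Multiset.mem_toFinset, Sigma.exists, Sigma.mk.injEq, heq_eq_eq]
    constructor
    · rintro ⟨⟨⟨h1, h2⟩, h3⟩, h4⟩
      rw [hP j (by omega)] at h3
      have ha : a ∈ M := by
        refine Multiset.mem_of_le h4 (Multiset.mem_map.2 ⟨0, Multiset.mem_range.2 h1, rfl⟩)
      have hm := minimalPeriod_pos_of_mem hF hM ha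
      have hd : Function.minimalPeriod F a ∣ j := Function.IsPeriodicPt.minimalPeriod_dvd h3
      rw [orbitMultiset_le_iff hF hM h3] at h4
      exact ⟨a, j / Function.minimalPeriod F a,
        ⟨ha, Nat.div_pos (Nat.le_of_dvd (by omega) hd) hm, h4⟩, Nat.div_mul_cancel hd, rfl⟩
    · rintro ⟨a, k, ⟨ha, hk1, hk2⟩, rfl, rfl⟩
      have hm := minimalPeriod_pos_of_mem hF hM ha
      have hp : F^[k * Function.minimalPeriod F a] a = a :=
        (Function.isPeriodicPt_minimalPeriod F a).const_mul k
      have hpos : 0 < k * Function.minimalPeriod F a := by positivity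
      have hle : orbitMultiset F a (k * Function.minimalPeriod F a) ≤ M := by
        rw [orbitMultiset_le_iff hF hM hp, Nat.mul_div_cancel _ hm]
        exact hk2
      refine ⟨⟨⟨hpos, ?_⟩, (hP _ hpos.ne' _).2 hp⟩, hle⟩
      simpa [card_orbitMultiset] using Multiset.card_le_card hle
  rw [this, Finset.card_image_of_injOn, Finset.card_sigma]
  · simp
  · rintro ⟨a, k⟩ h ⟨b, l⟩ - e
    simp only [Finset.coe_sigma, Set.mem_sigma_iff, Finset.mem_coe, Multiset.mem_toFinset] at h
    simp only [Sigma.mk.injEq, heq_eq_eq] at e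
    obtain ⟨e1, rfl⟩ := e
    have hm := minimalPeriod_pos_of_mem hF hM h.1
    rw [Nat.eq_of_mul_eq_mul_right hm e1]

/-- The recursion behind the Euler product: the sums of a multiplicative weight over the
`F`-stable multisets of given cardinality are determined by the sums over the periodic points. -/
theorem card_mul_sum_stable {R : Type*} [CommRing R] (hF : F.Injective) {P : ℕ → Finset α}
    (hP : ∀ j, j ≠ 0 → ∀ a, a ∈ P j ↔ F^[j] a = a) {C : ℕ → Finset (Multiset α)}
    (hC : ∀ n M, M ∈ C n ↔ M.map F = M ∧ M.card = n) (w : α → R) (n : ℕ) :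
    (n : R) * ∑ M ∈ C n, (M.map w).prod =
      ∑ j ∈ Finset.Icc 1 n, (∑ a ∈ P j, ((orbitMultiset F a j).map w).prod) *
        ∑ M ∈ C (n - j), (M.map w).prod := by
  -- Adding the orbit multiset is a bijection from the stable multisets of size `n - j` to those of
  -- size `n` that contain it. After exchanging the sums, each `M` of size `n` is counted `n` times.
  have key : ∀ x ∈ (Finset.Icc 1 n).sigma P,
      ((orbitMultiset F x.2 x.1).map w).prod * ∑ M ∈ C (n - x.1), (M.map w).prod =
      ∑ M ∈ (C n).filter (fun M => orbitMultiset F x.2 x.1 ≤ M), (M.map w).prod := by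
    rintro ⟨j, a⟩ hx
    simp only [Finset.mem_sigma, Finset.mem_Icc] at hx
    have ha := (hP j (by omega) a).1 hx.2
    rw [Finset.mul_sum]
    refine Finset.sum_bij' (fun M _ => orbitMultiset F a j + M)
      (fun M _ => M - orbitMultiset F a j) ?_ ?_ ?_ ?_ ?_
    · intro M hM
      rw [hC] at hM
      simp only [Finset.mem_filter, hC, Multiset.map_add, Multiset.card_add, card_orbitMultiset,
        map_orbitMultiset ha, hM.1, hM.2, true_and]
      exact ⟨by omega, Multiset.le_add_right _ _⟩
    · intro M hM
      simp only [Finset.mem_filter, hC] at hM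
      rw [hC, Multiset.card_sub hM.2, card_orbitMultiset, hM.1.2]
      refine ⟨?_, rfl⟩
      have := congrArg (Multiset.map F) (Multiset.sub_add_cancel hM.2)
      rw [Multiset.map_add, map_orbitMultiset ha, hM.1.1] at this
      exact (Multiset.eq_sub_of_add_eq this)
    · intro M _
      exact add_tsub_cancel_left _ _
    · intro M hM
      simp only [Finset.mem_filter, hC] at hM
      exact add_tsub_cancel_of_le hM.2
    · intro M _
      rw [Multiset.map_add, Multiset.prod_add]
  simp_rw [Finset.sum_mul]
  rw [Finset.sum_sigma' (Finset.Icc 1 n) P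
    (fun j a => ((orbitMultiset F a j).map w).prod * ∑ M ∈ C (n - j), (M.map w).prod),
    Finset.sum_congr rfl key]
  simp_rw [Finset.sum_filter]
  rw [Finset.sum_comm, Finset.mul_sum]
  refine Finset.sum_congr rfl fun M hM => ?_
  obtain ⟨h1, rfl⟩ := (hC n M).1 hM
  rw [← Finset.sum_filter, Finset.sum_const, card_filter_orbitMultiset_le hF hP h1, nsmul_eq_mul]

end OrbitMultiset

/-! ### Finite fields inside `E`, their traces, and an additive character. -/

section FrobeniusFixed

theorem pow_pow_comm_of_fixed {R : Type*} [CommMonoid R] (p : ℕ) {N : ℕ} {x : R}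
    (hx : x ^ p ^ N = x) (i : ℕ) : (x ^ i) ^ p ^ N = x ^ i := by
  rw [← pow_mul, mul_comm, pow_mul, hx]

variable (p : ℕ) [hp : Fact p.Prime] (E : Type*) [Field E]

open Classical in
/-- The elements of `E` fixed by the `N`-th power of Frobenius. -/
noncomputable def frobFixed (N : ℕ) : Finset E :=
  (X ^ p ^ N - X : E[X]).roots.toFinset

variable {E}

theorem mem_frobFixed {N : ℕ} (hN : N ≠ 0) {x : E} : x ∈ frobFixed p E N ↔ x ^ p ^ N = x := by
  have : (X ^ p ^ N - X : E[X]) ≠ 0 :=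
    FiniteField.X_pow_card_pow_sub_X_ne_zero E hN hp.out.one_lt
  simp [frobFixed, this, sub_eq_zero]

variable [CharP E p]

theorem card_frobFixed [IsAlgClosed E] {N : ℕ} (hN : N ≠ 0) :
    (frobFixed p E N).card = p ^ N := by
  classical
  have hs : (X ^ p ^ N - X : E[X]).Separable :=
    galois_poly_separable p _ (dvd_pow_self p hN)
  rw [frobFixed, Multiset.toFinset_card_of_nodup (nodup_roots hs),
    ← (IsAlgClosed.splits _).natDegree_eq_card_roots,
    FiniteField.X_pow_card_pow_sub_X_natDegree_eq E hN hp.out.one_lt]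

/-- The trace to the prime field of the elements fixed by the `N`-th power of Frobenius. -/
noncomputable def frobTrace (N : ℕ) : E →+ E :=
  ∑ i ∈ Finset.range N, (iterateFrobenius E p i).toAddMonoidHom

theorem frobTrace_apply (N : ℕ) (x : E) :
    frobTrace p N x = ∑ i ∈ Finset.range N, x ^ p ^ i := by
  simp [frobTrace, iterateFrobenius_def]

theorem frobTrace_pow {N : ℕ} {x : E} (hx : x ^ p ^ N = x) :
    frobTrace p N (x ^ p) = frobTrace p N x := by
  have h : ∑ i ∈ Finset.range N, x ^ p ^ (i + 1) + x ^ p ^ 0 =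
      ∑ i ∈ Finset.range N, x ^ p ^ i + x ^ p ^ N := by
    rw [← Finset.sum_range_succ' fun i => x ^ p ^ i, Finset.sum_range_succ]
  rw [hx, pow_zero, pow_one] at h
  simp only [frobTrace_apply, ← pow_mul, ← pow_succ']
  exact add_right_cancel h

theorem frobTrace_pow_pow {N : ℕ} {x : E} (hx : x ^ p ^ N = x) (i : ℕ) :
    frobTrace p N (x ^ p ^ i) = frobTrace p N x := by
  induction i with
  | zero => simp
  | succ i ih =>
    rw [pow_succ, pow_mul, frobTrace_pow p (pow_pow_comm_of_fixed p hx _), ih]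

theorem frobTrace_pow_self {N : ℕ} {x : E} (hx : x ^ p ^ N = x) :
    (frobTrace p N x) ^ p = frobTrace p N x := by
  conv_rhs => rw [← frobTrace_pow p hx]
  rw [frobTrace_apply, frobTrace_apply, sum_pow_char]
  exact Finset.sum_congr rfl fun i _ => pow_right_comm _ _ _

/-- Transitivity of the trace: the exponents below `N * j` are grouped into `j` blocks of length
`N`. -/
theorem frobTrace_mul (N j : ℕ) (x : E) :
    frobTrace p (N * j) x = ∑ i ∈ Finset.range j, frobTrace p N (x ^ p ^ (N * i)) := by
  induction j with
  | zero => simp [frobTrace_apply]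
  | succ j ih =>
    rw [Finset.sum_range_succ, ← ih]
    simp only [frobTrace_apply, mul_add, mul_one, Finset.sum_range_add, ← pow_mul, ← pow_add]

/-- The trace is a polynomial of degree `p ^ (N - 1)`, so it cannot vanish at all `p ^ N` elements
of the fixed field. -/
theorem exists_frobTrace_ne_zero [IsAlgClosed E] {N : ℕ} (hN : N ≠ 0) :
    ∃ x : E, x ^ p ^ N = x ∧ frobTrace p N x ≠ 0 := by
  by_contra! h
  obtain ⟨m, rfl⟩ := Nat.exists_eq_succ_of_ne_zero hN
  let t : E[X] := ∑ i ∈ Finset.range (m + 1), X ^ p ^ i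
  have h1 : t.coeff (p ^ m) = 1 := by
    simp only [t, finsetSum_coeff, coeff_X_pow]
    rw [Finset.sum_eq_single_of_mem m (by simp)]
    · simp
    · intro i _ hi
      rw [if_neg]
      exact fun e => hi (Nat.pow_right_injective hp.out.two_le e.symm)
  have h0 : t ≠ 0 := fun h0 => by simp [h0] at h1
  have hdeg : t.natDegree ≤ p ^ m := by
    refine natDegree_sum_le_of_forall_le _ _ fun i hi => ?_
    rw [natDegree_X_pow]
    exact Nat.pow_le_pow_right hp.out.pos (by simpa [Nat.lt_succ_iff] using hi)
  have := card_le_degree_of_subset_roots (p := t) (Z := frobFixed p E (m + 1)) (fun x hx => by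
    rw [mem_roots h0, IsRoot.def]
    have := h x ((mem_frobFixed p hN).1 hx)
    rw [frobTrace_apply] at this
    simpa [t, eval_finsetSum] using this)
  rw [card_frobFixed p hN] at this
  exact absurd (this.trans hdeg) (not_le.2 (Nat.pow_lt_pow_right hp.out.one_lt (Nat.lt_succ_self m)))

variable (E) in
-- An `𝔽_p`-linear functional on `E` that maps 1 to 1, followed by the standard character mod `p`,
-- is nontrivial on the prime field. One character of `E` then serves all finite subfields, through
-- their traces to the prime field.
theorem exists_addChar : ∃ ψ : AddChar E ℂ, ∀ x, x ^ p = x → ψ x = 1 → x = 0 := by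
  let := ZMod.algebra E p
  obtain ⟨ℓ, hℓ⟩ := Module.exists_dual_forall_apply_eq_one (K := ZMod p) (V := E)
    (s := (Set.univ : Set Unit)) (v := fun _ => 1) (by simp)
  refine ⟨(ZMod.stdAddChar (N := p)).compAddMonoidHom ℓ.toAddMonoidHom, fun x hx h => ?_⟩
  have hx' : x ∈ Set.range (algebraMap (ZMod p) E) := by
    have hne : (X ^ p - X : E[X]) ≠ 0 := FiniteField.X_pow_card_sub_X_ne_zero E hp.out.one_lt
    by_contra hx'
    have := card_le_degree_of_subset_roots (p := (X ^ p - X : E[X]))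
      (Z := Finset.cons x (Finset.univ.map ⟨_, (algebraMap (ZMod p) E).injective⟩)
        (by simpa using hx')) (fun y hy => by
          rw [mem_roots hne]
          rcases Multiset.mem_cons.1 hy with rfl | hy
          · simp [hx]
          · obtain ⟨z, -, rfl⟩ := Multiset.mem_map.1 hy
            simp [← map_pow, ZMod.pow_card])
    rw [FiniteField.X_pow_card_sub_X_natDegree_eq E hp.out.one_lt] at this
    simp [ZMod.card] at this
  obtain ⟨z, rfl⟩ := hx'
  have h1 : ℓ (algebraMap (ZMod p) E z) = z := by
    rw [Algebra.algebraMap_eq_smul_one, map_smul, hℓ () trivial, smul_eq_mul, mul_one]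
  have h2 : ZMod.stdAddChar z = ZMod.stdAddChar (0 : ZMod p) := by
    simpa [h1] using h
  rw [ZMod.injective_stdAddChar h2, map_zero]

end FrobeniusFixed

/-! ### Newton's identities and perturbation of one coefficient. -/

section Newton

variable {E : Type*} [Field E]

/-- The reversed polynomial is ∏ (1 - a X), and each factor contributes -a / (1 - a X) = -∑ a^(j+1)
X^j to the logarithmic derivative. -/
theorem reverse_prod_X_sub_C_derivative (M : Multiset E) :
    PowerSeries.derivative E (((M.map fun a => X - C a).prod.reverse : E[X]) : PowerSeries E) =
      -((((M.map fun a => X - C a).prod.reverse : E[X]) : PowerSeries E) *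
        PowerSeries.mk fun j => (M.map fun a => a ^ (j + 1)).sum) := by
  induction M using Multiset.induction_on with
  | empty =>
    have : (PowerSeries.mk fun _ => (0 : E)) = 0 := by ext; simp
    have h1 : (1 : E[X]).reverse = 1 := by rw [← C_1, reverse_C]
    simp [this, h1]
  | cons a M ih =>
    have h1 : (X - C a : E[X]).reverse = 1 - C a * X := by
      ext i
      rcases i with _ | _ | i
      · simp
      · rw [coeff_reverse, natDegree_X_sub_C, revAt_le (by simp)]
        simp [coeff_one]
      · rw [coeff_eq_zero_of_natDegree_lt ((reverse_natDegree_le _).trans_lt (by simp))]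
        simp [coeff_one]
    have h2 : (1 - PowerSeries.C a * PowerSeries.X) * (PowerSeries.mk fun j => a ^ (j + 1)) =
        PowerSeries.C a := by
      ext i
      rw [sub_mul, one_mul, mul_assoc, map_sub, PowerSeries.coeff_C_mul]
      cases i with
      | zero => simp
      | succ i =>
        simp [PowerSeries.coeff_succ_X_mul, pow_succ']
    have h3 : (PowerSeries.mk fun j => (((a ::ₘ M).map fun a => a ^ (j + 1)).sum)) =
        (PowerSeries.mk fun j => a ^ (j + 1)) +
          PowerSeries.mk fun j => (M.map fun a => a ^ (j + 1)).sum := by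
      ext i; simp
    rw [Multiset.map_cons, Multiset.prod_cons, reverse_mul_of_domain, h1, h3]
    push_cast
    rw [Derivation.leibniz, ih]
    simp only [smul_eq_mul, map_sub, Derivation.leibniz, PowerSeries.derivative_X,
      PowerSeries.derivative_C, Derivation.map_one_eq_zero]
    linear_combination ((((M.map fun a => X - C a).prod.reverse : E[X]) : PowerSeries E)) * h2

theorem natDegree_prod_X_sub_C (M : Multiset E) :
    (M.map fun a => X - C a).prod.natDegree = M.card := by
  simp

theorem newton_identity (M : Multiset E) {m : ℕ} (h1 : 1 ≤ m) (h2 : m ≤ M.card) :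
    (m : E) * (M.map fun a => X - C a).prod.coeff (M.card - m) =
      -∑ i ∈ Finset.range m, (M.map fun a => X - C a).prod.coeff (M.card - i) *
        (M.map fun a => a ^ (m - i)).sum := by
  have h := congrArg (PowerSeries.coeff (m - 1)) (reverse_prod_X_sub_C_derivative M)
  have hc : ∀ i ≤ M.card, (M.map fun a => X - C a).prod.reverse.coeff i =
      (M.map fun a => X - C a).prod.coeff (M.card - i) := fun i hi => by
    rw [coeff_reverse, natDegree_prod_X_sub_C, revAt_le hi]
  rw [PowerSeries.coeff_derivative, map_neg, PowerSeries.coeff_mul,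
    Finset.Nat.sum_antidiagonal_eq_sum_range_succ_mk] at h
  simp only [Nat.succ_eq_add_one, Polynomial.coeff_coe, PowerSeries.coeff_mk,
    Nat.sub_add_cancel h1] at h
  rw [hc m h2, Nat.cast_sub h1] at h
  have hs : ∀ i ∈ Finset.range m, (M.map fun a => X - C a).prod.reverse.coeff i *
        (M.map fun a => a ^ (m - 1 - i + 1)).sum =
      (M.map fun a => X - C a).prod.coeff (M.card - i) * (M.map fun a => a ^ (m - i)).sum := by
    intro i hi
    rw [Finset.mem_range] at hi
    rw [hc i (by omega), show m - 1 - i + 1 = m - i by omega]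
  rw [Finset.sum_congr rfl hs, Nat.cast_one, sub_add_cancel] at h
  rw [mul_comm, h]

/-- For a monic polynomial, Newton's identities give the `m`-th power sum from the top `m`
coefficients below the leading one and the lower power sums, without division, hence in any
characteristic. Only the coefficient at depth `d` changes, and it enters the `d`-th identity as `d *
t`. -/
theorem sum_pow_of_prod_X_sub_C_eq_add {M M' : Multiset E} {d : ℕ} {t : E} (hcard : M'.card = M.card)
    (hd : d ≤ M.card)
    (h : (M'.map fun a => X - C a).prod = (M.map fun a => X - C a).prod + C t * X ^ (M.card - d))
    {m : ℕ} (hm : 1 ≤ m) (hmd : m ≤ d) :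
    (M'.map fun a => a ^ m).sum = (M.map fun a => a ^ m).sum - if m = d then (d : E) * t else 0 := by
  induction m using Nat.strong_induction_on with
  | _ m ih =>
    have e := newton_identity M hm (hmd.trans hd)
    have e' := newton_identity M' hm (by omega)
    obtain ⟨k, rfl⟩ := Nat.exists_eq_add_of_le' hm
    have hcoeff : ∀ i ≤ d, (M'.map fun a => X - C a).prod.coeff (M.card - i) =
        (M.map fun a => X - C a).prod.coeff (M.card - i) + if i = d then t else 0 := fun i hi => by
      rw [h, coeff_add, coeff_C_mul_X_pow]
      congr 2
      exact propext ⟨fun _ => by omega, fun _ => by omega⟩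
    have hlead : (M.map fun a => X - C a).prod.coeff M.card = 1 := by
      have := (monic_multiset_prod_of_monic M (fun a => X - C a) fun a _ => monic_X_sub_C a)
      rw [Monic, leadingCoeff, natDegree_prod_X_sub_C] at this
      exact this
    rw [hcard, Finset.sum_range_succ', hcoeff _ hmd] at e'
    rw [Finset.sum_range_succ'] at e
    have hs : ∑ i ∈ Finset.range k, (M'.map fun a => X - C a).prod.coeff (M.card - (i + 1)) *
          (M'.map fun a => a ^ (k + 1 - (i + 1))).sum =
        ∑ i ∈ Finset.range k, (M.map fun a => X - C a).prod.coeff (M.card - (i + 1)) *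
          (M.map fun a => a ^ (k + 1 - (i + 1))).sum := by
      refine Finset.sum_congr rfl fun i hi => ?_
      rw [Finset.mem_range] at hi
      rw [hcoeff _ (by omega), ih (k + 1 - (i + 1)) (by omega) (by omega) (by omega),
        if_neg (by omega), if_neg (by omega), add_zero, sub_zero]
    have hc0 := hcoeff 0 (by omega)
    rw [if_neg (by omega), add_zero] at hc0
    rw [hs, hc0] at e'
    simp only [Nat.sub_zero, hlead, one_mul] at e e'
    split_ifs at e' ⊢ with hkd
    · rw [← hkd]
      linear_combination e' - e
    · linear_combination e' - e

theorem sum_map_eval (g : E[X]) (M : Multiset E) :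
    (M.map fun a => g.eval a).sum =
      ∑ i ∈ Finset.range (g.natDegree + 1), g.coeff i * (M.map fun a => a ^ i).sum := by
  induction M using Multiset.induction_on with
  | empty => simp
  | cons a M ih =>
    rw [Multiset.map_cons, Multiset.sum_cons, ih, eval_eq_sum_range]
    simp [mul_add, Finset.sum_add_distrib]

/-- Adding `t X ^ (n - d)` to a monic polynomial of degree `n` changes the sum of the values of a
polynomial `g` of degree `d ≥ 1` at the roots by `- d t` times the leading coefficient of `g`. -/
theorem sum_map_eval_of_prod_X_sub_C_eq_add {M M' : Multiset E} {g : E[X]} {t : E}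
    (hcard : M'.card = M.card) (hg : g.natDegree ≠ 0) (hd : g.natDegree ≤ M.card)
    (h : (M'.map fun a => X - C a).prod =
      (M.map fun a => X - C a).prod + C t * X ^ (M.card - g.natDegree)) :
    (M'.map fun a => g.eval a).sum =
      (M.map fun a => g.eval a).sum - g.natDegree * g.leadingCoeff * t := by
  rw [sum_map_eval, sum_map_eval, Finset.sum_range_succ, Finset.sum_range_succ,
    sum_pow_of_prod_X_sub_C_eq_add hcard hd h (by omega) le_rfl, if_pos rfl]
  have : ∀ i ∈ Finset.range g.natDegree, g.coeff i * (M'.map fun a => a ^ i).sum =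
      g.coeff i * (M.map fun a => a ^ i).sum := fun i hi => by
    rw [Finset.mem_range] at hi
    rcases Nat.eq_zero_or_pos i with rfl | hi0
    · simp [hcard]
    · rw [sum_pow_of_prod_X_sub_C_eq_add hcard hd h hi0 hi.le, if_neg hi.ne, sub_zero]
  rw [Finset.sum_congr rfl this, leadingCoeff]
  ring

end Newton

/-! ### L-polynomials of exponential sums, and character counts of Artin–Schreier fibres. -/

section ExponentialSum

variable (p : ℕ) [hp : Fact p.Prime] {E : Type*} [Field E] [CharP E p]

theorem iterate_iterateFrobenius (N j : ℕ) (a : E) :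
    (iterateFrobenius E p N)^[j] a = a ^ p ^ (N * j) := by
  rw [← iterateFrobenius_mul_apply, iterateFrobenius_def]

theorem iterateFrobenius_injective (N : ℕ) : Function.Injective (iterateFrobenius E p N) :=
  (iterateFrobenius E p N).injective

/-- Each element lies on a cycle contained in `M`, of length at most `n`, so it is fixed by the `N *
n!`-th power of Frobenius. Its multiplicity is at most `n`. -/
theorem finite_stable_multisets {N : ℕ} (hN : N ≠ 0) (n : ℕ) :
    {M : Multiset E | M.map (iterateFrobenius E p N) = M ∧ M.card = n}.Finite := by
  classical
  refine (Set.finite_Iic (n • (frobFixed p E (N * n.factorial)).val)).subset ?_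
  rintro M ⟨hM, hn⟩
  rw [Set.mem_Iic, Multiset.le_iff_count]
  intro a
  by_cases ha : a ∈ M
  · have hF := iterateFrobenius_injective p (E := E) N
    have hm := minimalPeriod_pos_of_mem hF hM ha
    have hper := Function.iterate_minimalPeriod (f := iterateFrobenius E p N) (x := a)
    have h1 : orbitMultiset (iterateFrobenius E p N) a
        (Function.minimalPeriod (iterateFrobenius E p N) a) ≤ M := by
      rw [orbitMultiset_le_iff hF hM hper, Nat.div_self hm]
      exact Multiset.one_le_count_iff_mem.2 ha
    have h2 := Multiset.card_le_card h1
    rw [card_orbitMultiset, hn] at h2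
    have h3 : a ∈ frobFixed p E (N * n.factorial) := by
      rw [mem_frobFixed p (mul_ne_zero hN n.factorial_ne_zero), ← iterate_iterateFrobenius]
      exact Function.isPeriodicPt_iff_minimalPeriod_dvd.2 (Nat.dvd_factorial hm h2)
    rw [Multiset.count_nsmul, Multiset.count_eq_one_of_mem (frobFixed p E _).nodup h3, mul_one,
      ← hn]
    exact Multiset.count_le_card _ _
  · simp [Multiset.count_eq_zero_of_notMem ha]

theorem prod_map_addChar {A : Type*} [AddCommMonoid A] {R : Type*} [CommMonoid R]
    (θ : AddChar A R) {ι : Type*} (M : Multiset ι) (f : ι → A) :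
    (M.map fun a => θ (f a)).prod = θ (M.map f).sum := by
  induction M using Multiset.induction_on with
  | empty => simp
  | cons a M ih => simp [ih, AddChar.map_add_eq_mul]

theorem eval_iterateFrobenius {N : ℕ} {g : E[X]} (hg : g.map (iterateFrobenius E p N) = g) (a : E)
    (i : ℕ) : g.eval ((iterateFrobenius E p N)^[i] a) = (g.eval a) ^ p ^ (N * i) := by
  rw [← iterate_iterateFrobenius]
  induction i with
  | zero => rfl
  | succ i ih =>
    rw [Function.iterate_succ_apply', Function.iterate_succ_apply', ← ih]
    conv_lhs => rw [← hg]
    rw [eval_map, eval₂_hom]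

/-- Since `g` commutes with Frobenius, the values along an orbit are conjugates of `g(a)`. The
weight of an orbit multiset is thus a term of the exponential sum over the extension of degree `j`.
-/
theorem frobTrace_sum_orbitMultiset {N : ℕ} {g : E[X]} (hg : g.map (iterateFrobenius E p N) = g)
    (a : E) (j : ℕ) :
    frobTrace p N ((orbitMultiset (iterateFrobenius E p N) a j).map fun b => g.eval b).sum =
      frobTrace p (N * j) (g.eval a) := by
  rw [frobTrace_mul, ← map_sum]
  congr 1
  simp only [orbitMultiset, Multiset.map_map, Function.comp_def, eval_iterateFrobenius p hg]
  rfl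

include hp in
theorem isIntegral_addChar (ψ : AddChar E ℂ) (x : E) : IsIntegral ℤ (ψ x) := by
  refine IsIntegral.of_pow hp.out.pos ?_
  rw [← AddChar.map_nsmul_eq_pow, nsmul_eq_mul, CharP.cast_eq_zero, zero_mul,
    AddChar.map_zero_eq_one]
  exact isIntegral_one

variable [IsAlgClosed E]

theorem roots_map_iterateFrobenius {N : ℕ} {h : E[X]}
    (hh : h.map (iterateFrobenius E p N) = h) :
    h.roots.map (iterateFrobenius E p N) = h.roots := by
  conv_rhs => rw [← hh]
  exact ((IsAlgClosed.splits h).roots_map _).symm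

/-- The additive character sum over all monic polynomials of degree `n ≥ deg g` vanishes. -/
theorem sum_stable_eq_zero {N : ℕ} (hN : N ≠ 0) {g : E[X]}
    (hg : g.map (iterateFrobenius E p N) = g) (hd : g.natDegree.Coprime p)
    {ψ : AddChar E ℂ} (hψ : ∀ x, x ^ p = x → ψ x = 1 → x = 0) {n : ℕ} (hn : g.natDegree ≤ n)
    {S : Finset (Multiset E)}
    (hS : ∀ M, M ∈ S ↔ M.map (iterateFrobenius E p N) = M ∧ M.card = n) :
    ∑ M ∈ S, ψ (frobTrace p N (M.map fun a => g.eval a).sum) = 0 := by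
  have hd0 : g.natDegree ≠ 0 := fun h => by
    rw [h, Nat.coprime_zero_left] at hd
    exact hp.out.ne_one hd
  have hdE : (g.natDegree : E) ≠ 0 := by
    rw [Ne, CharP.cast_eq_zero_iff E p]
    exact fun h => hp.out.ne_one (Nat.eq_one_of_dvd_coprimes hd h dvd_rfl)
  have hlc : g.leadingCoeff ≠ 0 := leadingCoeff_ne_zero.2 fun h => by simp [h] at hd0
  have hfix : iterateFrobenius E p N ((g.natDegree : E) * g.leadingCoeff) =
      g.natDegree * g.leadingCoeff := by
    rw [map_mul, map_natCast, leadingCoeff]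
    conv_rhs => rw [← hg]
    rw [coeff_map, hg]
  obtain ⟨x, hx, hx0⟩ := exists_frobTrace_ne_zero p (E := E) hN
  -- Adding `t X ^ (n - deg g)` changes the sum of the values of `g` at the roots by `-(deg g) * lc
  -- * t`. This choice makes the change equal to `x`, whose trace is nonzero.
  set t : E := -x / (g.natDegree * g.leadingCoeff) with ht
  have htfix : iterateFrobenius E p N t = t := by
    rw [ht, map_div₀, hfix, map_neg, iterateFrobenius_def, hx]
  -- Frobenius-stable multisets of size `n` correspond to monic polynomials of degree `n` over the
  -- fixed field. `Q` is the perturbed polynomial, and passing to its roots permutes `S`.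
  let P : Multiset E → E[X] := fun M => (M.map fun a => X - C a).prod
  let Q : E → Multiset E → E[X] := fun t M => P M + C t * X ^ (n - g.natDegree)
  have hPm : ∀ M, (P M).Monic := fun M =>  by
    exact monic_multiset_prod_of_monic M (fun a => X - C a) fun a _ => monic_X_sub_C a
  have hlt : ∀ (t : E) (M : Multiset E), M.card = n → (C t * X ^ (n - g.natDegree)).degree < (P M).degree := by
    intro t M hM
    refine (degree_C_mul_X_pow_le (n - g.natDegree) t).trans_lt ?_
    rw [degree_eq_natDegree (hPm M).ne_zero, natDegree_prod_X_sub_C, hM]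
    exact_mod_cast (by omega : n - g.natDegree < n)
  have hQm : ∀ t M, M.card = n → (Q t M).Monic := fun t M hM =>
    (hPm M).add_of_left (hlt t M hM)
  have hQdeg : ∀ t M, M.card = n → (Q t M).natDegree = n := fun t M hM => by
    rw [natDegree_eq_of_degree_eq (degree_add_eq_left_of_degree_lt (hlt t M hM)),
      natDegree_prod_X_sub_C, hM]
  have hcard : ∀ t M, M.card = n → (Q t M).roots.card = n := fun t M hM => by
    rw [← (IsAlgClosed.splits _).natDegree_eq_card_roots, hQdeg t M hM]
  have hPQ : ∀ t M, M.card = n → P (Q t M).roots = Q t M := fun t M hM =>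
    ((IsAlgClosed.splits (Q t M)).eq_prod_roots_of_monic (hQm t M hM)).symm
  have hPmap : ∀ M, (P M).map (iterateFrobenius E p N) = P (M.map (iterateFrobenius E p N)) := by
    intro M
    simp [P, Polynomial.map_multiset_prod, Multiset.map_map]
  have hmem : ∀ t, iterateFrobenius E p N t = t → ∀ M ∈ S, (Q t M).roots ∈ S := by
    intro t ht M hM
    rw [hS] at hM ⊢
    refine ⟨roots_map_iterateFrobenius p ?_, hcard t M hM.2⟩
    simp only [Q, Polynomial.map_add, hPmap, hM.1, Polynomial.map_mul, map_C, Polynomial.map_pow,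
      map_X, ht]
  have hinv : ∀ t M, M.card = n → (Q (-t) (Q t M).roots).roots = M := by
    intro t M hM
    have : Q (-t) (Q t M).roots = P M := by
      change P _ + _ = _
      rw [hPQ t M hM]
      simp [Q]
    rw [this]
    exact roots_multiset_prod_X_sub_C M
  have hsum : ∀ M ∈ S, ((Q t M).roots.map fun a => g.eval a).sum =
      (M.map fun a => g.eval a).sum + x := by
    intro M hM
    rw [hS] at hM
    rw [sum_map_eval_of_prod_X_sub_C_eq_add (t := t) (hcard t M hM.2 |>.trans hM.2.symm) hd0
      (by omega) (by rw [hM.2]; exact hPQ t M hM.2), ht]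
    field_simp
    ring
  have hshift : ∑ M ∈ S, ψ (frobTrace p N (M.map fun a => g.eval a).sum) =
      ∑ M ∈ S, ψ (frobTrace p N ((Q t M).roots.map fun a => g.eval a).sum) := by
    symm
    refine Finset.sum_bij' (fun M _ => (Q t M).roots) (fun M _ => (Q (-t) M).roots)
      (hmem t htfix) (hmem (-t) (by rw [map_neg, htfix])) ?_ ?_ ?_
    · exact fun M hM => hinv t M ((hS M).1 hM).2
    · intro M hM
      have := hinv (-t) M ((hS M).1 hM).2
      rwa [neg_neg] at this
    · exact fun _ _ => rfl
  have hmul : ∀ M ∈ S, ψ (frobTrace p N ((Q t M).roots.map fun a => g.eval a).sum) =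
      ψ (frobTrace p N (M.map fun a => g.eval a).sum) * ψ (frobTrace p N x) := fun M hM => by
    rw [hsum M hM, map_add, AddChar.map_add_eq_mul]
  rw [Finset.sum_congr rfl hmul, ← Finset.sum_mul] at hshift
  have hne : ψ (frobTrace p N x) ≠ 1 := fun h => hx0 (hψ _ (frobTrace_pow_self p hx) h)
  by_contra h0
  exact hne (mul_left_cancel₀ h0 (by rw [mul_one]; exact hshift.symm))

/-- The `L`-function of the exponential sums of a polynomial `g` whose degree is prime to the
characteristic is a polynomial of degree at most `deg g - 1` with integral coefficients. -/
theorem exists_exponentialSum_lPolynomial {N : ℕ} (hN : N ≠ 0) {g : E[X]}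
    (hg : g.map (iterateFrobenius E p N) = g) (hd : g.natDegree.Coprime p)
    {ψ : AddChar E ℂ} (hψ : ∀ x, x ^ p = x → ψ x = 1 → x = 0) :
    ∃ L : ℂ[X], L.natDegree ≤ g.natDegree - 1 ∧ L.coeff 0 = 1 ∧
      (∀ i, IsIntegral ℤ (L.coeff i)) ∧
      ∀ n : ℕ, (n : ℂ) * L.coeff n = ∑ j ∈ Finset.Icc 1 n,
        (∑ a ∈ frobFixed p E (N * j), ψ (frobTrace p (N * j) (g.eval a))) * L.coeff (n - j) := by
  classical
  let T : ℕ → Finset (Multiset E) := fun n => (finite_stable_multisets p (E := E) hN n).toFinset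
  have hT : ∀ n M, M ∈ T n ↔ M.map (iterateFrobenius E p N) = M ∧ M.card = n := by
    simp [T]
  let θ : AddChar E ℂ := ψ.compAddMonoidHom (frobTrace p N)
  -- The coefficients of the expanded Euler product, as sums over monic polynomials of degree `n`;
  -- they vanish for `n ≥ deg g`.
  let c : ℕ → ℂ := fun n => ∑ M ∈ T n, (M.map fun a => θ (g.eval a)).prod
  have hc0 : ∀ n, g.natDegree ≤ n → c n = 0 := by
    intro n hn
    rw [← sum_stable_eq_zero p hN hg hd hψ hn (hT n)]
    exact Finset.sum_congr rfl fun M _ => prod_map_addChar θ M _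
  have hd0 : g.natDegree ≠ 0 := fun h => by
    rw [h, Nat.coprime_zero_left] at hd
    exact hp.out.ne_one hd
  let L : ℂ[X] := ∑ i ∈ Finset.range g.natDegree, C (c i) * X ^ i
  have hL : ∀ i, L.coeff i = c i := by
    intro i
    simp only [L, finsetSum_coeff, coeff_C_mul_X_pow, Finset.sum_ite_eq, Finset.mem_range]
    split_ifs with h
    · rfl
    · exact (hc0 i (not_lt.1 h)).symm
  refine ⟨L, ?_, ?_, ?_, ?_⟩
  · exact natDegree_le_iff_coeff_eq_zero.2 fun i hi => by rw [hL, hc0 i (by omega)]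
  · have : T 0 = {0} := by
      ext M
      rw [hT, Finset.mem_singleton, Multiset.card_eq_zero]
      exact ⟨fun h => h.2, fun h => by simp [h]⟩
    rw [hL]
    simp [c, this]
  · intro i
    rw [hL]
    refine IsIntegral.sum _ fun M _ => IsIntegral.multiset_prod fun z hz => ?_
    obtain ⟨a, -, rfl⟩ := Multiset.mem_map.1 hz
    exact isIntegral_addChar p ψ _
  · intro n
    have hP : ∀ j, j ≠ 0 → ∀ a, a ∈ frobFixed p E (N * j) ↔
        (iterateFrobenius E p N)^[j] a = a := by
      intro j hj a
      rw [mem_frobFixed p (mul_ne_zero hN hj), iterate_iterateFrobenius]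
    have := card_mul_sum_stable (iterateFrobenius_injective p N) hP hT
      (fun a => θ (g.eval a)) n
    simp only [hL]
    rw [this]
    refine Finset.sum_congr rfl fun j _ => ?_
    congr 1
    refine Finset.sum_congr rfl fun a _ => ?_
    rw [prod_map_addChar, ← frobTrace_sum_orbitMultiset p hg]
    rfl

theorem sum_addChar_eq_zero {A : Type*} [AddCommGroup A] {S : Finset A} {θ : AddChar A ℂ} {x : A}
    (hS : ∀ y, y ∈ S ↔ y + x ∈ S) (hx : θ x ≠ 1) : ∑ y ∈ S, θ y = 0 := by
  have h : ∑ y ∈ S, θ y = ∑ y ∈ S, θ (y + x) :=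
    (Finset.sum_equiv (Equiv.addRight x) hS fun _ _ => rfl).symm
  simp_rw [AddChar.map_add_eq_mul, ← Finset.sum_mul] at h
  by_contra h0
  exact hx (mul_left_cancel₀ h0 (by rw [mul_one]; exact h.symm))

/-- The number of solutions of `b ^ (p ^ u) - b = v` in the field fixed by the `N`-th power of
Frobenius, as a character sum. -/
theorem card_filter_artinSchreier {u N : ℕ} (hu : u ≠ 0) (hN : N ≠ 0)
    {ψ : AddChar E ℂ} (hψ : ∀ x, x ^ p = x → ψ x = 1 → x = 0) {v : E} (hv : v ∈ frobFixed p E N)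
    [DecidableEq E] :
    (((frobFixed p E N).filter fun b => b ^ p ^ u - b = v).card : ℂ) =
      ∑ c ∈ (frobFixed p E u).filter (· ∈ frobFixed p E N), ψ (frobTrace p N (c * v)) := by
  classical
  set A := frobFixed p E N
  -- `K` is the kernel of b ↦ b^(p^u) - b on the field `A`; only these `c` occur in the sum.
  set K := (frobFixed p E u).filter (· ∈ A) with hK
  have hA : ∀ x, x ∈ A ↔ iterateFrobenius E p N x = x := fun x => mem_frobFixed p hN
  have hKm : ∀ x, x ∈ K ↔ iterateFrobenius E p u x = x ∧ iterateFrobenius E p N x = x := fun x => by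
    rw [hK, Finset.mem_filter, hA, mem_frobFixed p hu, iterateFrobenius_def,
      iterateFrobenius_def]
  have hAadd : ∀ x ∈ A, ∀ y, y ∈ A ↔ y + x ∈ A := fun x hx y => by
    rw [hA] at hx
    rw [hA, hA, map_add, hx, add_left_inj]
  have hKadd : ∀ x ∈ K, ∀ y, y ∈ K ↔ y + x ∈ K := fun x hx y => by
    rw [hKm] at hx
    rw [hKm, hKm, map_add, map_add, hx.1, hx.2, add_left_inj, add_left_inj]
  have hK0 : (0 : E) ∈ K := by simp [hKm]
  let θ : E → AddChar E ℂ := fun c =>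
    ψ.compAddMonoidHom ((frobTrace p N).comp (AddMonoidHom.mulLeft c))
  have hθ : ∀ c v, θ c v = ψ (frobTrace p N (c * v)) := fun _ _ => rfl
  have hθ' : ∀ c v, θ c v = θ v c := fun c v => by rw [hθ, hθ, mul_comm]
  -- By orthogonality of characters, `W v` is the right-hand side.
  let W : E → ℕ := fun v => if ∀ c ∈ K, θ v c = 1 then K.card else 0
  have hW : ∀ v, ∑ c ∈ K, θ v c = W v := by
    intro v
    by_cases h : ∀ c ∈ K, θ v c = 1
    · rw [Finset.sum_congr rfl h]
      simp [W, if_pos h]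
    · have : W v = 0 := if_neg h
      rw [this, Nat.cast_zero]
      push Not at h
      obtain ⟨c, hc, h⟩ := h
      exact sum_addChar_eq_zero (hKadd c hc) h
  let B : E → ℕ := fun v => (A.filter fun b => b ^ p ^ u - b = v).card
  -- A nonempty fibre injects into `K` by subtracting one of its points, and its value is orthogonal
  -- to `K` because the trace is Frobenius invariant. Both `B` and `W` sum to the size of `A`, so
  -- the inequalities are equalities.
  have hBW : ∀ v ∈ A, B v ≤ W v := by
    intro v hv
    rcases (A.filter fun b => b ^ p ^ u - b = v).eq_empty_or_nonempty with h | ⟨b, hb⟩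
    · simp [B, h]
    · rw [Finset.mem_filter] at hb
      obtain ⟨hb, rfl⟩ := hb
      have hone : ∀ c ∈ K, θ (b ^ p ^ u - b) c = 1 := by
        intro c hc
        rw [hKm, iterateFrobenius_def, iterateFrobenius_def] at hc
        have h1 : (c * b) ^ p ^ N = c * b := by
          rw [mul_pow, hc.2]
          congr 1
          exact (hA b).1 hb
        have h2 : c * (b ^ p ^ u - b) = (c * b) ^ p ^ u - c * b := by
          rw [mul_pow, hc.1]; ring
        rw [hθ', hθ, h2, map_sub, frobTrace_pow_pow p h1, sub_self, AddChar.map_zero_eq_one]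
      have : W (b ^ p ^ u - b) = K.card := if_pos hone
      rw [this]
      refine Finset.card_le_card_of_injOn (· - b) ?_ (fun x _ y _ h => sub_left_injective h)
      intro x hx
      simp only [Finset.coe_filter, Set.mem_ofPred_eq] at hx
      rw [Finset.mem_coe, hKm, map_sub, map_sub, (hA x).1 hx.1, (hA b).1 hb, iterateFrobenius_def,
        iterateFrobenius_def]
      exact ⟨by linear_combination hx.2, rfl⟩
  have hsumB : ∑ v ∈ A, B v = A.card := by
    symm
    refine Finset.card_eq_sum_card_fiberwise fun b hb => ?_
    rw [Finset.mem_coe, hA] at hb ⊢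
    rw [map_sub, map_pow, hb]
  have hsumW : ∑ v ∈ A, W v = A.card := by
    have : ((∑ v ∈ A, W v : ℕ) : ℂ) = A.card := by
      push_cast
      simp_rw [← hW]
      rw [Finset.sum_comm, Finset.sum_congr rfl fun c _ => Finset.sum_congr rfl fun v _ => hθ' v c, Finset.sum_eq_single_of_mem 0 hK0]
      · simp [hθ]
      · intro c hc hc0
        obtain ⟨x, hx, hx0⟩ := exists_frobTrace_ne_zero p (E := E) hN
        refine sum_addChar_eq_zero (x := x / c) (hAadd _ ?_) ?_
        · rw [hA, map_div₀, ((hKm c).1 hc).2, iterateFrobenius_def, hx]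
        · rw [hθ, mul_div_cancel₀ _ hc0]
          exact fun h => hx0 (hψ _ (frobTrace_pow_self p hx) h)
    exact_mod_cast this
  have := (Finset.sum_eq_sum_iff_of_le hBW).1 (hsumB.trans hsumW.symm) v hv
  calc ((B v : ℕ) : ℂ) = W v := by rw [this]
    _ = _ := by
      rw [← hW]
      exact Finset.sum_congr rfl fun c _ => hθ' _ _

end ExponentialSum

/-! ### The place at infinity. -/

section InfinitePlace

variable {k F : Type*} [Field k] [Field F] [Algebra k F]

/-- The valuation ring `V` of `F` contains `k` and not `x`. -/
structure IsAtInfinity (k : Type*) {F : Type*} [Field k] [Field F] [Algebra k F] (x : F)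
    (V : ValuationSubring F) : Prop where
  algebraMap_mem : ∀ a : k, algebraMap k F a ∈ V
  notMem : x ∉ V

namespace IsAtInfinity

variable {x : F} {V : ValuationSubring F}

theorem one_lt (h : IsAtInfinity k x V) : 1 < V.valuation x := by
  rw [← not_le, V.valuation_le_one_iff]
  exact h.notMem

theorem valuation_algebraMap (h : IsAtInfinity k x V) {a : k} (ha : a ≠ 0) :
    V.valuation (algebraMap k F a) = 1 := by
  refine le_antisymm ((V.valuation_le_one_iff _).2 (h.algebraMap_mem a)) ?_
  have := (V.valuation_le_one_iff _).2 (h.algebraMap_mem a⁻¹)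
  rw [map_inv₀, map_inv₀] at this
  exact (inv_le_one₀ (zero_lt_iff.2 ((V.valuation.ne_zero_iff).2
    ((_root_.map_ne_zero _).2 ha)))).1 this

/-- The integral closure of `k` in `F` is integrally closed in `F`, so an element outside it, such
as a transcendental one, is excluded by some valuation ring containing it. -/
theorem exists_of_transcendental (hx : Transcendental k x) :
    ∃ V : ValuationSubring F, IsAtInfinity k x V := by
  have : IsIntegrallyClosedIn (integralClosure k F).toSubring F :=
    inferInstanceAs (IsIntegrallyClosedIn (integralClosure k F) F)
  obtain ⟨V, hV, hxV⟩ := Subring.exists_le_valuationSubring_of_isIntegrallyClosedIn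
    (R := (integralClosure k F).toSubring) (x := x) fun h => hx (IsIntegral.isAlgebraic h)
  exact ⟨V, fun a => hV ((integralClosure k F).algebraMap_mem a), hxV⟩

end IsAtInfinity

/-- In a linear combination of elements whose values at all places at infinity are distinct, one
term dominates. -/
theorem exists_dominant_term {x : F} {ι : Type*} {s : Finset ι} (hs : s.Nonempty) {c : ι → k}
    (hc : ∀ i ∈ s, c i ≠ 0) {m : ι → F} {w : ι → ℕ} (hw : Set.InjOn w s) {q : ℕ} (hq : q ≠ 0)
    (hm : ∀ V, IsAtInfinity k x V → ∀ i ∈ s, V.valuation (m i) ^ q = V.valuation x ^ w i) :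
    ∃ i ∈ s, ∀ V, IsAtInfinity k x V →
      V.valuation (∑ j ∈ s, algebraMap k F (c j) * m j - algebraMap k F (c i) * m i) <
        V.valuation (m i) := by
  classical
  obtain ⟨i, hi, hmax⟩ := Finset.exists_max_image s w hs
  refine ⟨i, hi, fun V hV => ?_⟩
  rw [← Finset.add_sum_erase s _ hi, add_sub_cancel_left]
  have h1 := hV.one_lt
  have hne : V.valuation (m i) ≠ 0 := fun h0 => by
    have := hm V hV i hi
    rw [h0, zero_pow hq] at this
    exact pow_ne_zero _ (zero_lt_one.trans h1).ne' this.symm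
  refine V.valuation.map_sum_lt hne fun j hj => ?_
  rw [Finset.mem_erase] at hj
  rw [map_mul, hV.valuation_algebraMap (hc j hj.2), one_mul]
  refine lt_of_pow_lt_pow_left₀ q zero_le ?_
  rw [hm V hV j hj.2, hm V hV i hi]
  exact pow_lt_pow_right₀ h1 (lt_of_le_of_ne (hmax j hj.2) fun h => hj.1 (hw hj.2 hi h))

theorem valuation_eq_of_sub_lt {R Γ : Type*} [Ring R] [LinearOrderedCommGroupWithZero Γ]
    (v : Valuation R Γ) {a b : R} (h : v (a - b) < v b) : v a = v b := by
  have := v.map_add_eq_of_lt_left h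
  rwa [add_sub_cancel] at this

theorem IsAtInfinity.valuation_aeval {x : F} {V : ValuationSubring F} (hV : IsAtInfinity k x V)
    {r : k[X]} (hr : r ≠ 0) : V.valuation (aeval x r) = V.valuation x ^ r.natDegree := by
  have hs : ∀ i ∈ r.support, r.coeff i ≠ 0 := fun i => mem_support_iff.1
  have hm : ∀ i, V.valuation (algebraMap k F (r.coeff i) * x ^ i) =
      if i ∈ r.support then V.valuation x ^ i else 0 := by
    intro i
    split_ifs with h
    · rw [map_mul, hV.valuation_algebraMap (hs i h), one_mul, map_pow]
    · simp [notMem_support_iff.1 h]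
  rw [aeval_eq_sum_range, Finset.sum_range_succ, Valuation.map_add_eq_of_lt_right]
  · rw [Algebra.smul_def, hm, if_pos (natDegree_mem_support_of_nonzero hr)]
  · rw [Algebra.smul_def, hm, if_pos (natDegree_mem_support_of_nonzero hr)]
    refine V.valuation.map_sum_lt (pow_ne_zero _ (zero_lt_one.trans hV.one_lt).ne') fun i hi => ?_
    rw [Algebra.smul_def, hm]
    split_ifs
    · exact pow_lt_pow_right₀ hV.one_lt (Finset.mem_range.1 hi)
    · exact pow_pos (zero_lt_one.trans hV.one_lt) _

theorem valuation_pow_sub_self {V : ValuationSubring F} {y : F} {q : ℕ} (hq : 1 < q)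
    (hy : y ∉ V) : V.valuation (y ^ q - y) = V.valuation y ^ q := by
  have h1 : 1 < V.valuation y := by rwa [← not_le, V.valuation_le_one_iff]
  rw [← map_pow]
  apply Valuation.map_sub_eq_of_lt_left
  rw [map_pow]
  exact lt_self_pow₀ h1 hq

variable {q d : ℕ} {f : k[X]} {x y : F}

theorem IsAtInfinity.valuation_y_pow (hq : 1 < q) (hd : f.natDegree ≠ 0)
    (hxy : y ^ q - y = aeval x f) {V : ValuationSubring F} (hV : IsAtInfinity k x V) :
    V.valuation y ^ q = V.valuation x ^ f.natDegree := by
  have hf : f ≠ 0 := fun h => hd (by simp [h])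
  rw [← hV.valuation_aeval hf, ← hxy, valuation_pow_sub_self hq]
  intro hy
  have h1 : V.valuation (aeval x f) ≤ 1 := by
    rw [V.valuation_le_one_iff, ← hxy]
    exact sub_mem (pow_mem hy q) hy
  rw [hV.valuation_aeval hf] at h1
  exact h1.not_gt (one_lt_pow₀ hV.one_lt hd)

/-- The value at `(x, y)` of a polynomial in two variables. -/
noncomputable abbrev evalPair (k : Type*) {F : Type*} [Field k] [Field F] [Algebra k F] (x y : F) :
    k[X][X] →+* F :=
  eval₂RingHom (aeval x : k[X] →ₐ[k] F).toRingHom y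

/-- At infinity the `q`-th power of the value of x^e y^i is the value of x to the power q e + d i,
with d = deg f. For i < q these exponents are pairwise distinct, since d is invertible mod q. The
dominant monomial is the one of largest exponent, the same for every place at infinity. -/
theorem exists_dominant_monomial (hq : 1 < q) (hd : f.natDegree ≠ 0)
    (hdq : f.natDegree.Coprime q) (hxy : y ^ q - y = aeval x f) {R : k[X][X]} (hR : R ≠ 0)
    (hRq : R.natDegree < q) :
    ∃ r : k, r ≠ 0 ∧ ∃ e i : ℕ, i < q ∧ ∀ V, IsAtInfinity k x V →
      V.valuation (evalPair k x y R - algebraMap k F r * (x ^ e * y ^ i)) <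
        V.valuation (x ^ e * y ^ i) := by
  let s : Finset (Σ _ : ℕ, ℕ) := R.support.sigma fun i => (R.coeff i).support
  have hs : s.Nonempty := by
    have h1 := natDegree_mem_support_of_nonzero hR
    exact ⟨⟨_, _⟩, Finset.mem_sigma.2 ⟨h1, natDegree_mem_support_of_nonzero (mem_support_iff.1 h1)⟩⟩
  have hlt : ∀ a ∈ s, a.1 < q := fun a ha =>
    (le_natDegree_of_mem_supp _ (Finset.mem_sigma.1 ha).1).trans_lt hRq
  have hw : Set.InjOn (fun a : Σ _ : ℕ, ℕ => q * a.2 + f.natDegree * a.1) s := by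
    rintro ⟨i, e⟩ h1 ⟨j, e'⟩ h2 h
    have hi := hlt _ h1
    have hj := hlt _ h2
    simp only at h hi hj
    have h3 : f.natDegree * i ≡ f.natDegree * j [MOD q] := by
      have := congrArg (· % q) h
      simpa [Nat.ModEq, Nat.add_mod] using this
    have hij : i = j := by
      have := Nat.ModEq.cancel_left_of_coprime (Nat.coprime_comm.1 hdq) h3
      rwa [Nat.ModEq, Nat.mod_eq_of_lt hi, Nat.mod_eq_of_lt hj] at this
    subst hij
    have : e = e' := Nat.eq_of_mul_eq_mul_left (by omega : 0 < q) (by omega)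
    rw [this]
  obtain ⟨⟨i, e⟩, hi, h⟩ := exists_dominant_term (k := k) (x := x) hs
    (c := fun a => (R.coeff a.1).coeff a.2)
    (fun a ha => mem_support_iff.1 (Finset.mem_sigma.1 ha).2) (m := fun a => x ^ a.2 * y ^ a.1)
    hw (by omega : q ≠ 0) (fun V hV a _ => by
      rw [map_mul, map_pow, map_pow, mul_pow, ← pow_mul, ← pow_mul, mul_comm a.1, pow_mul _ q,
        hV.valuation_y_pow hq hd hxy, ← pow_mul, pow_add, mul_comm a.2])
  refine ⟨(R.coeff i).coeff e, mem_support_iff.1 (Finset.mem_sigma.1 hi).2, e, i, hlt _ hi,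
    fun V hV => ?_⟩
  have hsum : evalPair k x y R =
      ∑ a ∈ s, algebraMap k F ((R.coeff a.1).coeff a.2) * (x ^ a.2 * y ^ a.1) := by
    rw [Finset.sum_sigma, coe_eval₂RingHom, eval₂_eq_sum, Polynomial.sum_def]
    refine Finset.sum_congr rfl fun i _ => ?_
    simp only [AlgHom.toRingHom_eq_coe, RingHom.coe_coe]
    rw [aeval_def, eval₂_eq_sum, Polynomial.sum_def, Finset.sum_mul]
    exact Finset.sum_congr rfl fun e _ => by ring
  rw [hsum]
  exact h V hV

theorem evalPair_ne_zero (hq : 1 < q) (hd : f.natDegree ≠ 0) (hx : Transcendental k x)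
    (hdq : f.natDegree.Coprime q) (hxy : y ^ q - y = aeval x f) {R : k[X][X]} (hR : R ≠ 0)
    (hRq : R.natDegree < q) : evalPair k x y R ≠ 0 := by
  obtain ⟨r, hr, e, i, -, h⟩ := exists_dominant_monomial hq hd hdq hxy hR hRq
  obtain ⟨V, hV⟩ := IsAtInfinity.exists_of_transcendental hx
  intro h0
  have := h V hV
  rw [h0, zero_sub, Valuation.map_neg, map_mul, hV.valuation_algebraMap hr, one_mul] at this
  exact this.false

/-- The polynomial `Y ^ q - Y - f(X)`. -/
noncomputable def artinSchreierPoly (q : ℕ) (f : k[X]) : k[X][X] := X ^ q - X - C f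

theorem artinSchreierPoly_monic (hq : 1 < q) (f : k[X]) : (artinSchreierPoly q f).Monic := by
  rw [artinSchreierPoly, sub_sub]
  refine monic_X_pow_sub (n := q) ?_
  exact (degree_add_le _ _).trans_lt (max_lt (degree_X_le.trans_lt (by exact_mod_cast hq))
    (degree_C_le.trans_lt (by exact_mod_cast (by omega : 0 < q))))

theorem natDegree_artinSchreierPoly (hq : 1 < q) (f : k[X]) :
    (artinSchreierPoly q f).natDegree = q := by
  rw [artinSchreierPoly, sub_sub, natDegree_sub_eq_left_of_natDegree_lt, natDegree_X_pow]
  rw [natDegree_X_pow]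
  exact (natDegree_add_le _ _).trans_lt (max_lt (natDegree_X_le.trans_lt hq) (by simp; omega))

theorem evalPair_modByMonic (hxy : y ^ q - y = aeval x f) (R : k[X][X]) :
    evalPair k x y (R %ₘ artinSchreierPoly q f) = evalPair k x y R := by
  conv_rhs => rw [← modByMonic_add_div R (artinSchreierPoly q f)]
  rw [map_add, map_mul]
  have : evalPair k x y (artinSchreierPoly q f) = 0 := by
    simp [artinSchreierPoly, hxy]
  rw [this, zero_mul, add_zero]

theorem exists_eq_evalPair_div (hF : IsFunctionFieldOf k F q f x y) (z : F) :
    ∃ R S : k[X][X], z = evalPair k x y R / evalPair k x y S := by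
  have hz : z ∈ IntermediateField.adjoin k {x, y} := by rw [hF.adjoin_eq_top]; trivial
  obtain ⟨a, ha, b, hb, rfl⟩ := IntermediateField.mem_adjoin_iff_div.1 hz
  have key : ∀ a ∈ Algebra.adjoin k {x, y}, ∃ R : k[X][X], a = evalPair k x y R := by
    intro a ha
    induction ha using Algebra.adjoin_induction with
    | mem a ha =>
      rcases ha with rfl | rfl
      · exact ⟨C X, by simp⟩
      · exact ⟨X, by simp⟩
    | algebraMap r => exact ⟨C (C r), by simp⟩
    | add a b _ _ h1 h2 =>
      obtain ⟨R, rfl⟩ := h1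
      obtain ⟨S, rfl⟩ := h2
      exact ⟨R + S, (map_add _ _ _).symm⟩
    | mul a b _ _ h1 h2 =>
      obtain ⟨R, rfl⟩ := h1
      obtain ⟨S, rfl⟩ := h2
      exact ⟨R * S, (map_mul _ _ _).symm⟩
  obtain ⟨R, rfl⟩ := key a ha
  obtain ⟨S, rfl⟩ := key b hb
  exact ⟨R, S, rfl⟩

/-- Every nonzero function is the quotient of two functions with a dominant monomial. -/
theorem exists_dominant_quotient (hF : IsFunctionFieldOf k F q f x y) (hq : 1 < q)
    (hd : f.natDegree ≠ 0) (hdq : f.natDegree.Coprime q) {z : F} (hz : z ≠ 0) :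
    ∃ a b : F, ∃ r s : k, ∃ e i e' i' : ℕ, z = a / b ∧ r ≠ 0 ∧ s ≠ 0 ∧ i < q ∧ i' < q ∧
      ∀ V, IsAtInfinity k x V →
        V.valuation (a - algebraMap k F r * (x ^ e * y ^ i)) < V.valuation (x ^ e * y ^ i) ∧
        V.valuation (b - algebraMap k F s * (x ^ e' * y ^ i')) < V.valuation (x ^ e' * y ^ i') := by
  obtain ⟨R, S, h⟩ := exists_eq_evalPair_div hF z
  rw [← evalPair_modByMonic hF.equation R, ← evalPair_modByMonic hF.equation S] at h
  have hdeg : ∀ R : k[X][X], (R %ₘ artinSchreierPoly q f).natDegree < q := fun R => by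
    have := natDegree_modByMonic_lt R (artinSchreierPoly_monic hq f) (fun h => by
      have := natDegree_artinSchreierPoly hq f
      rw [h, natDegree_one] at this
      omega)
    rwa [natDegree_artinSchreierPoly hq] at this
  obtain ⟨r, hr, e, i, hi, h1⟩ := exists_dominant_monomial hq hd hdq hF.equation
    (R := R %ₘ artinSchreierPoly q f) (fun h0 => hz (by rw [h, h0]; simp)) (hdeg R)
  obtain ⟨s, hs, e', i', hi', h2⟩ := exists_dominant_monomial hq hd hdq hF.equation
    (R := S %ₘ artinSchreierPoly q f) (fun h0 => hz (by rw [h, h0]; simp)) (hdeg S)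
  exact ⟨_, _, r, s, e, i, e', i', h, hr, hs, hi, hi', fun V hV => ⟨h1 V hV, h2 V hV⟩⟩

theorem IsAtInfinity.valuation_monomial_pow (hF : IsFunctionFieldOf k F q f x y) (hq : 1 < q)
    (hd : f.natDegree ≠ 0) {V : ValuationSubring F} (hV : IsAtInfinity k x V) (e i : ℕ) :
    V.valuation (x ^ e * y ^ i) ^ q = V.valuation x ^ (q * e + f.natDegree * i) := by
  rw [map_mul, map_pow, map_pow, mul_pow, ← pow_mul, ← pow_mul, mul_comm i, pow_mul _ q i,
    hV.valuation_y_pow hq hd hF.equation, ← pow_mul, pow_add, mul_comm e]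

theorem IsAtInfinity.valuation_eq_monomial {V : ValuationSubring F} (hV : IsAtInfinity k x V)
    {a m : F} {r : k} (hr : r ≠ 0) (h : V.valuation (a - algebraMap k F r * m) < V.valuation m) :
    V.valuation a = V.valuation m := by
  have hm : V.valuation (algebraMap k F r * m) = V.valuation m := by
    rw [map_mul, hV.valuation_algebraMap hr, one_mul]
  rw [← hm] at h ⊢
  exact valuation_eq_of_sub_lt _ h

theorem IsAtInfinity.monomial_le_iff (hF : IsFunctionFieldOf k F q f x y) (hq : 1 < q)
    (hd : f.natDegree ≠ 0) {V : ValuationSubring F} (hV : IsAtInfinity k x V) (e i e' i' : ℕ) :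
    V.valuation (x ^ e * y ^ i) ≤ V.valuation (x ^ e' * y ^ i') ↔
      q * e + f.natDegree * i ≤ q * e' + f.natDegree * i' := by
  rw [← pow_le_pow_iff_left₀ zero_le zero_le (by omega : q ≠ 0),
    hV.valuation_monomial_pow hF hq hd, hV.valuation_monomial_pow hF hq hd,
    pow_le_pow_iff_right₀ hV.one_lt]

/-- There is at most one place at infinity. -/
theorem IsAtInfinity.unique (hF : IsFunctionFieldOf k F q f x y) (hq : 1 < q)
    (hd : f.natDegree ≠ 0) (hdq : f.natDegree.Coprime q) {V W : ValuationSubring F}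
    (hV : IsAtInfinity k x V) (hW : IsAtInfinity k x W) : V = W := by
  ext z
  rcases eq_or_ne z 0 with rfl | hz
  · simp [zero_mem]
  obtain ⟨a, b, r, s, e, i, e', i', rfl, hr, hs, -, -, h⟩ :=
    exists_dominant_quotient hF hq hd hdq hz
  have hb : b ≠ 0 := fun h => hz (by simp [h])
  -- Membership of `a / b` is decided by the exponents of the two dominant monomials, which do not
  -- depend on `V`.
  have key : ∀ V, IsAtInfinity k x V →
      (a / b ∈ V ↔ q * e + f.natDegree * i ≤ q * e' + f.natDegree * i') := by
    intro V hV
    rw [← V.valuation_le_one_iff, map_div₀,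
      div_le_one₀ (zero_lt_iff.2 (V.valuation.ne_zero_iff.2 hb)),
      hV.valuation_eq_monomial hr (h V hV).1, hV.valuation_eq_monomial hs (h V hV).2,
      hV.monomial_le_iff hF hq hd]
  rw [key V hV, key W hW]

/-- The place at infinity is rational. -/
theorem IsAtInfinity.exists_valuation_sub_lt_one (hF : IsFunctionFieldOf k F q f x y) (hq : 1 < q)
    (hd : f.natDegree ≠ 0) (hdq : f.natDegree.Coprime q) {V : ValuationSubring F}
    (hV : IsAtInfinity k x V) {z : F} (hz : z ∈ V) :
    ∃ c : k, V.valuation (z - algebraMap k F c) < 1 := by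
  rcases ((V.valuation_le_one_iff z).2 hz).lt_or_eq with hlt | heq
  · exact ⟨0, by simpa using hlt⟩
  have hz0 : z ≠ 0 := fun h => by simp [h] at heq
  obtain ⟨a, b, r, s, e, i, e', i', rfl, hr, hs, hi, hi', h⟩ :=
    exists_dominant_quotient hF hq hd hdq hz0
  have hb : b ≠ 0 := fun h => hz0 (by simp [h])
  have hvb : 0 < V.valuation b := zero_lt_iff.2 (V.valuation.ne_zero_iff.2 hb)
  obtain ⟨h1, h2⟩ := h V hV
  have ha' := hV.valuation_eq_monomial hr h1
  have hb' := hV.valuation_eq_monomial hs h2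
  rw [map_div₀, div_eq_one_iff_eq hvb.ne', ha', hb'] at heq
  have hw : q * e + f.natDegree * i = q * e' + f.natDegree * i' :=
    le_antisymm ((hV.monomial_le_iff hF hq hd _ _ _ _).1 heq.le)
      ((hV.monomial_le_iff hF hq hd _ _ _ _).1 heq.ge)
  have hii : i = i' := by
    have h3 : f.natDegree * i ≡ f.natDegree * i' [MOD q] := by
      have := congrArg (· % q) hw
      simpa [Nat.ModEq, Nat.add_mod] using this
    have := Nat.ModEq.cancel_left_of_coprime (Nat.coprime_comm.1 hdq) h3
    rwa [Nat.ModEq, Nat.mod_eq_of_lt hi, Nat.mod_eq_of_lt hi'] at this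
  subst hii
  have hee : e = e' := Nat.eq_of_mul_eq_mul_left (by omega : 0 < q) (by omega)
  subst hee
  -- Value 1 forces numerator and denominator to have the same dominant monomial, so the residue is
  -- the ratio of their leading coefficients.
  refine ⟨r / s, ?_⟩
  have hs' : algebraMap k F s ≠ 0 := (_root_.map_ne_zero _).2 hs
  have e1 : a / b - algebraMap k F (r / s) =
      ((a - algebraMap k F r * (x ^ e * y ^ i)) - algebraMap k F (r / s) *
        (b - algebraMap k F s * (x ^ e * y ^ i))) / b := by
    rw [map_div₀]
    field_simp
    ring
  rw [e1, map_div₀, div_lt_one₀ hvb, hb']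
  refine (V.valuation.map_sub _ _).trans_lt (max_lt h1 ?_)
  rwa [map_mul, hV.valuation_algebraMap (div_ne_zero hr hs), one_mul]

end InfinitePlace

/-! ### Extending a homomorphism to a local ring with principal maximal ideal. -/

section LocalPoint

variable {A F K : Type*} [CommRing A] [IsDomain A] [Field F] [Algebra A F] [IsFractionRing A F]
  [Field K]

/-- If the kernel of `φ` is locally principal, any two elements of `A` are comparable for
divisibility in the localization of `A` at the kernel. -/
theorem exists_mul_eq_mul_of_locally_principal [IsNoetherianRing A] {φ : A →+* K} {ϖ : A}
    (hϖ : φ ϖ = 0) (h : ∀ n, φ n = 0 → ∃ s m, φ s ≠ 0 ∧ s * n = ϖ * m) (a b : A) :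
    ∃ n s, φ s ≠ 0 ∧ (a * n = b * s ∨ b * n = a * s) := by
  let P : Ideal A := RingHom.ker φ
  have hP : P.IsPrime := RingHom.ker_isPrime φ
  let B := Localization.AtPrime P
  have : IsNoetherianRing B := IsLocalization.isNoetherianRing P.primeCompl B inferInstance
  have hinj : Function.Injective (algebraMap A B) :=
    IsLocalization.injective B P.primeCompl_le_nonZeroDivisors
  have : IsDomain B := IsLocalization.isDomain_localization P.primeCompl_le_nonZeroDivisors
  have hprin : (IsLocalRing.maximalIdeal B).IsPrincipal := by
    refine ⟨algebraMap A B ϖ, le_antisymm ?_ ?_⟩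
    · intro z hz
      obtain ⟨n, s, rfl⟩ := IsLocalization.exists_mk'_eq P.primeCompl z
      rw [IsLocalization.AtPrime.mk'_mem_maximal_iff B P] at hz
      obtain ⟨t, m, ht, e⟩ := h n hz
      rw [Ideal.submodule_span_eq, Ideal.mem_span_singleton]
      have ht' : t ∈ P.primeCompl := ht
      refine ⟨IsLocalization.mk' B m (⟨t, ht'⟩ * s : P.primeCompl), ?_⟩
      rw [IsLocalization.mul_mk'_eq_mk'_of_mul, IsLocalization.mk'_eq_iff_eq]
      congr 1
      change t * s * n = s * (ϖ * m)
      rw [← e]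
      ring
    · rw [Ideal.submodule_span_eq, Ideal.span_singleton_le_iff_mem]
      exact (IsLocalization.AtPrime.to_map_mem_maximal_iff B P ϖ).2 hϖ
  -- A Noetherian local domain with principal maximal ideal is a valuation ring.
  have : ValuationRing B := ((tfae_of_isNoetherianRing_of_isLocalRing_of_isDomain B).out 4 1).1 hprin
  have key : ∀ a b c, algebraMap A B a * c = algebraMap A B b → ∃ n s, φ s ≠ 0 ∧ a * n = b * s := by
    intro a b c hc
    obtain ⟨n, s, rfl⟩ := IsLocalization.exists_mk'_eq P.primeCompl c
    refine ⟨n, s, s.2, hinj ?_⟩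
    rw [map_mul, map_mul, ← hc, mul_assoc, IsLocalization.mk'_spec]
  obtain ⟨c, hc | hc⟩ := ValuationRing.cond (algebraMap A B a) (algebraMap A B b)
  · obtain ⟨n, s, hs, e⟩ := key a b c hc
    exact ⟨n, s, hs, Or.inl e⟩
  · obtain ⟨n, s, hs, e⟩ := key b a c hc
    exact ⟨n, s, hs, Or.inr e⟩

/-- `ev` is a local homomorphism on a valuation ring containing `A`, extending `φ`. -/
structure IsLocalExtension (φ : A →+* K) (V : ValuationSubring F) (ev : V →+* K) : Prop where
  mem : ∀ a, algebraMap A F a ∈ V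
  isLocalHom : IsLocalHom ev
  eval_eq : ∀ a, ev ⟨algebraMap A F a, mem a⟩ = φ a

theorem ValuationSubring.inv_mem_of_eval_ne_zero {V : ValuationSubring F} {ev : V →+* K}
    (h : IsLocalHom ev) {z : F} (hz : z ∈ V) (h0 : ev ⟨z, hz⟩ ≠ 0) : z⁻¹ ∈ V := by
  have hu : IsUnit (⟨z, hz⟩ : V) := h.map_nonunit _ (isUnit_iff_ne_zero.2 h0)
  obtain ⟨w, hw⟩ := hu.exists_right_inv
  have : z * (w : F) = 1 := congrArg Subtype.val hw
  rw [inv_eq_of_mul_eq_one_right this]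
  exact w.2

namespace IsLocalExtension

variable {φ : A →+* K} {V : ValuationSubring F} {ev : V →+* K}

omit [IsDomain A] [IsFractionRing A F] in
theorem div_mem (h : IsLocalExtension φ V ev) {n s : A} (hs : φ s ≠ 0) :
    algebraMap A F n / algebraMap A F s ∈ V := by
  rw [div_eq_mul_inv]
  refine mul_mem (h.mem n) (V.inv_mem_of_eval_ne_zero h.isLocalHom (h.mem s) ?_)
  rwa [h.eval_eq]

omit [IsDomain A] [IsFractionRing A F] in
theorem eval_div (h : IsLocalExtension φ V ev) {n s : A} (hs : φ s ≠ 0)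
    (hz : algebraMap A F n / algebraMap A F s ∈ V) : ev ⟨_, hz⟩ = φ n / φ s := by
  rw [eq_div_iff hs, ← h.eval_eq, ← h.eval_eq, ← map_mul]
  congr 1
  have hs0 : algebraMap A F s ≠ 0 := fun h0 => hs (by
    rw [← h.eval_eq]
    rw [← map_zero ev]
    exact congrArg ev (Subtype.ext h0))
  exact Subtype.ext (div_mul_cancel₀ _ hs0)

/-- By comparability, `z` or its inverse is a fraction with denominator outside the kernel. If `z⁻¹
= n / s` with `φ n = 0`, evaluating `z * z⁻¹ = 1` would give 0 = 1. Hence `V` is the localization at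
the kernel of `φ`, and `φ` determines both `V` and `ev`. -/
theorem exists_eq_div [IsNoetherianRing A] {ϖ : A} (hϖ : φ ϖ = 0)
    (hp : ∀ n, φ n = 0 → ∃ s m, φ s ≠ 0 ∧ s * n = ϖ * m) (h : IsLocalExtension φ V ev) {z : F}
    (hz : z ∈ V) : ∃ n s, φ s ≠ 0 ∧ z = algebraMap A F n / algebraMap A F s := by
  obtain ⟨a, b, hb, rfl⟩ := IsFractionRing.div_surjective (A := A) z
  have hb0 : algebraMap A F b ≠ 0 := IsFractionRing.to_map_ne_zero_of_mem_nonZeroDivisors hb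
  obtain ⟨n, s, hs, e | e⟩ := exists_mul_eq_mul_of_locally_principal hϖ hp b a
  · refine ⟨n, s, hs, ?_⟩
    have hs0 : algebraMap A F s ≠ 0 := (map_ne_zero_iff _ (IsFractionRing.injective A F)).2
      fun h0 => hs (by simp [h0])
    rw [div_eq_div_iff hb0 hs0, ← map_mul, ← map_mul, ← e, mul_comm]
  · have hs0 : algebraMap A F s ≠ 0 := (map_ne_zero_iff _ (IsFractionRing.injective A F)).2
      fun h0 => hs (by simp [h0])
    rcases eq_or_ne a 0 with rfl | ha
    · exact ⟨0, 1, by simp, by simp⟩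
    have ha0 : algebraMap A F a ≠ 0 := (map_ne_zero_iff _ (IsFractionRing.injective A F)).2 ha
    have hinv : (algebraMap A F a / algebraMap A F b)⁻¹ = algebraMap A F n / algebraMap A F s := by
      rw [inv_div, div_eq_div_iff ha0 hs0, ← map_mul, ← map_mul, ← e, mul_comm]
    by_cases hn : φ n = 0
    · exfalso
      have hw : algebraMap A F n / algebraMap A F s ∈ V := h.div_mem hs
      have h1 : ev ⟨_, hz⟩ * ev ⟨_, hw⟩ = 1 := by
        rw [← map_mul]
        convert map_one ev
        refine Subtype.ext ?_
        change algebraMap A F a / algebraMap A F b * (algebraMap A F n / algebraMap A F s) = 1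
        exact hinv ▸ mul_inv_cancel₀ (div_ne_zero ha0 hb0)
      rw [h.eval_div hs, hn, zero_div, mul_zero] at h1
      exact zero_ne_one h1
    · exact ⟨s, n, hn, by rw [← inv_inj, hinv, inv_div]⟩

theorem le [IsNoetherianRing A] {ϖ : A} (hϖ : φ ϖ = 0)
    (hp : ∀ n, φ n = 0 → ∃ s m, φ s ≠ 0 ∧ s * n = ϖ * m) (h : IsLocalExtension φ V ev)
    {V' : ValuationSubring F} {ev' : V' →+* K} (h' : IsLocalExtension φ V' ev') {z : F}
    (hz : z ∈ V) : ∃ hz' : z ∈ V', ev ⟨z, hz⟩ = ev' ⟨z, hz'⟩ := by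
  obtain ⟨n, s, hs, rfl⟩ := exists_eq_div hϖ hp h hz
  exact ⟨h'.div_mem hs, by rw [h.eval_div hs, h'.eval_div hs]⟩

end IsLocalExtension

/-- `V` is the localization at the kernel of `φ`, realized inside `F`. Comparability for
divisibility makes it a valuation ring. -/
theorem exists_isLocalExtension [IsNoetherianRing A] {φ : A →+* K} {ϖ : A} (hϖ : φ ϖ = 0)
    (hp : ∀ n, φ n = 0 → ∃ s m, φ s ≠ 0 ∧ s * n = ϖ * m) :
    ∃ (V : ValuationSubring F) (ev : V →+* K), IsLocalExtension φ V ev := by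
  have hne : ∀ s, φ s ≠ 0 → algebraMap A F s ≠ 0 := fun s hs =>
    (map_ne_zero_iff _ (IsFractionRing.injective A F)).2 fun h0 => hs (by simp [h0])
  let V : ValuationSubring F :=
    { carrier := {z | ∃ n s, φ s ≠ 0 ∧ z * algebraMap A F s = algebraMap A F n}
      mul_mem' := by
        rintro a b ⟨n, s, hs, ha⟩ ⟨m, t, ht, hb⟩
        refine ⟨n * m, s * t, by simp [hs, ht], ?_⟩
        rw [map_mul, map_mul, ← ha, ← hb]; ring
      one_mem' := ⟨1, 1, by simp, by simp⟩
      add_mem' := by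
        rintro a b ⟨n, s, hs, ha⟩ ⟨m, t, ht, hb⟩
        refine ⟨n * t + m * s, s * t, by simp [hs, ht], ?_⟩
        rw [map_mul, map_add, map_mul, map_mul, ← ha, ← hb]; ring
      zero_mem' := ⟨0, 1, by simp, by simp⟩
      neg_mem' := by
        rintro a ⟨n, s, hs, ha⟩
        exact ⟨-n, s, hs, by rw [map_neg, ← ha]; ring⟩
      mem_or_inv_mem' := by
        intro z
        obtain ⟨a, b, hb, rfl⟩ := IsFractionRing.div_surjective (A := A) z
        have hb0 : algebraMap A F b ≠ 0 := IsFractionRing.to_map_ne_zero_of_mem_nonZeroDivisors hb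
        rcases eq_or_ne a 0 with rfl | ha
        · exact Or.inl ⟨0, 1, by simp, by simp⟩
        have ha0 : algebraMap A F a ≠ 0 := (map_ne_zero_iff _ (IsFractionRing.injective A F)).2 ha
        obtain ⟨n, s, hs, e | e⟩ := exists_mul_eq_mul_of_locally_principal hϖ hp b a
        · refine Or.inl ⟨n, s, hs, ?_⟩
          rw [div_mul_eq_mul_div, ← map_mul, ← e, map_mul, mul_div_cancel_left₀ _ hb0]
        · refine Or.inr ⟨n, s, hs, ?_⟩
          rw [inv_div, div_mul_eq_mul_div, ← map_mul, ← e, map_mul, mul_div_cancel_left₀ _ ha0] }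
  have hV : ∀ z : V, ∃ n s, φ s ≠ 0 ∧ (z : F) * algebraMap A F s = algebraMap A F n := fun z => z.2
  choose n s hs hz using hV
  have key : ∀ (z : V) (m t : A), φ t ≠ 0 → (z : F) * algebraMap A F t = algebraMap A F m →
      φ (n z) / φ (s z) = φ m / φ t := by
    intro z m t ht h
    rw [div_eq_div_iff (hs z) ht, ← map_mul, ← map_mul]
    congr 1
    apply IsFractionRing.injective A F
    rw [map_mul, map_mul, ← h, ← hz]
    ring
  let ev : V →+* K :=
    { toFun := fun z => φ (n z) / φ (s z)
      map_one' := by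
        rw [key 1 1 1 (by simp) (by simp)]; simp
      map_zero' := by
        rw [key 0 0 1 (by simp) (by simp)]; simp
      map_mul' := fun z w => by
        rw [key (z * w) (n z * n w) (s z * s w) (by simp [hs]) (by
          change (z : F) * w * _ = _
          rw [map_mul, map_mul, ← hz, ← hz]; ring), map_mul, map_mul,
          mul_div_mul_comm]
      map_add' := fun z w => by
        rw [key (z + w) (n z * s w + s z * n w) (s z * s w) (by simp [hs]) (by
          change ((z : F) + w) * _ = _
          rw [map_mul, map_add, map_mul, map_mul, ← hz, ← hz]; ring), map_add, map_mul,
          map_mul, map_mul, div_add_div _ _ (hs z) (hs w)] }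
  refine ⟨V, ev, fun a => ⟨a, 1, by simp, by simp⟩, ⟨fun z h => ?_⟩, fun a => ?_⟩
  · have h0 : φ (n z) ≠ 0 := fun h0 => h.ne_zero (by
      change φ (n z) / φ (s z) = 0
      rw [h0, zero_div])
    have hz0 : (z : F) ≠ 0 := fun hz0 => hne _ h0 (by rw [← hz, hz0, zero_mul])
    refine IsUnit.of_mul_eq_one ⟨(z : F)⁻¹, s z, n z, h0, ?_⟩ (Subtype.ext ?_)
    · rw [← hz, inv_mul_cancel_left₀ hz0]
    · exact mul_inv_cancel₀ hz0
  · change φ (n _) / φ (s _) = φ a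
    rw [key _ a 1 (by simp) (by simp)]
    simp

end LocalPoint

/-! ### The affine coordinate ring and its smoothness. -/

section FinitePlace

variable {k F : Type*} [Field k] [Field F] [Algebra k F] {q : ℕ} {f : k[X]}

/-- The homomorphism from the coordinate ring `k[X, Y] / (Y ^ q - Y - f(X))` that is given by a
solution of the equation. -/
noncomputable def coordHom {S : Type*} [CommRing S] [Algebra k S] {x y : S}
    (h : y ^ q - y = aeval x f) : AdjoinRoot (artinSchreierPoly q f) →+* S :=
  AdjoinRoot.lift (aeval x : k[X] →ₐ[k] S).toRingHom y (by simp [artinSchreierPoly, h])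

section CoordHom

variable {S : Type*} [CommRing S] [Algebra k S] {x y : S} (h : y ^ q - y = aeval x f)

theorem coordHom_of (r : k[X]) : coordHom h (AdjoinRoot.of _ r) = aeval x r := by
  simp [coordHom]

theorem coordHom_root : coordHom h (AdjoinRoot.root _) = y := by
  simp [coordHom]

theorem coordRing_ringHom_ext {S : Type*} [CommRing S]
    {g g' : AdjoinRoot (artinSchreierPoly q f) →+* S}
    (h1 : ∀ c, g (AdjoinRoot.of _ (C c)) = g' (AdjoinRoot.of _ (C c)))
    (h2 : g (AdjoinRoot.of _ X) = g' (AdjoinRoot.of _ X))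
    (h3 : g (AdjoinRoot.root _) = g' (AdjoinRoot.root _)) : g = g' :=
  AdjoinRoot.ringHom_ext (Polynomial.ringHom_ext h1 h2) h3

theorem coordRing_of_eq_aeval (r : k[X]) : AdjoinRoot.of (artinSchreierPoly q f) r =
    aeval (AdjoinRoot.of (artinSchreierPoly q f) X) r := by
  have : AdjoinRoot.of (artinSchreierPoly q f) =
      (aeval (AdjoinRoot.of (artinSchreierPoly q f) X) : k[X] →ₐ[k] _).toRingHom :=
    Polynomial.ringHom_ext (fun c => by simp; rfl) (by simp)
  exact congrArg (fun g => g r) this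

theorem coordRing_equation : (AdjoinRoot.root (artinSchreierPoly q f)) ^ q - AdjoinRoot.root _ =
    aeval (AdjoinRoot.of (artinSchreierPoly q f) X) f := by
  have : AdjoinRoot.mk (artinSchreierPoly q f) (X ^ q - X - C f) = 0 := AdjoinRoot.mk_self
  rw [map_sub, map_sub, map_pow, AdjoinRoot.mk_X, AdjoinRoot.mk_C, sub_eq_zero] at this
  rw [this, ← coordRing_of_eq_aeval]

theorem aeval_pow_char_pow {p m : ℕ} [Fact p.Prime] [CharP S p] (hk : ∀ c : k, c ^ p ^ m = c)
    (x : S) (r : k[X]) : aeval (x ^ p ^ m) r = (aeval x r) ^ p ^ m := by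
  have : (aeval (x ^ p ^ m) : k[X] →ₐ[k] S).toRingHom =
      (iterateFrobenius S p m).comp (aeval x : k[X] →ₐ[k] S).toRingHom := by
    refine Polynomial.ringHom_ext (fun c => ?_) ?_
    · simp [iterateFrobenius_def, ← map_pow, hk]
    · simp [iterateFrobenius_def]
  exact congrArg (fun g => g r) this

end CoordHom

theorem coordHom_injective {x y : F} (hF : IsFunctionFieldOf k F q f x y) (hq : 1 < q)
    (hd : f.natDegree ≠ 0) (hdq : f.natDegree.Coprime q) :
    Function.Injective (coordHom hF.equation) := by
  rw [injective_iff_map_eq_zero]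
  intro a ha
  obtain ⟨R, rfl⟩ := AdjoinRoot.mk_surjective a
  have hm := artinSchreierPoly_monic hq f
  have h1 : evalPair k x y (R %ₘ artinSchreierPoly q f) = 0 := by
    rw [evalPair_modByMonic hF.equation, ← ha]
    simp [coordHom]
  by_contra h0
  refine evalPair_ne_zero hq hd hF.transcendental hdq hF.equation (R := R %ₘ artinSchreierPoly q f)
    (fun h => h0 ?_) ?_ h1
  · rw [AdjoinRoot.mk_eq_zero]
    exact (modByMonic_eq_zero_iff_dvd hm).1 h
  · have := natDegree_modByMonic_lt R hm (fun h => by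
      have := natDegree_artinSchreierPoly hq f
      rw [h, natDegree_one] at this
      omega)
    rwa [natDegree_artinSchreierPoly hq] at this

variable {K : Type*} [Field K] [Algebra k K] [Finite K]

/-- The affine Artin-Schreier curve is smooth: at a point with values in a finite field with `B`
elements, `x ^ B - x` generates the maximal ideal of the local ring. -/
theorem coordHom_locally_principal {p u : ℕ} [hp : Fact p.Prime] [CharP k p] (hu : u ≠ 0)
    (hdom : IsDomain (AdjoinRoot (artinSchreierPoly (p ^ u) f))) {a b : K}
    (hab : b ^ p ^ u - b = aeval a f) :
    ∃ ϖ, coordHom hab ϖ = 0 ∧ ∀ n, coordHom hab n = 0 →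
      ∃ s m, coordHom hab s ≠ 0 ∧ s * n = ϖ * m := by
  have := Fintype.ofFinite K
  have : CharP K p := charP_of_injective_algebraMap (algebraMap k K).injective p
  have : CharP (AdjoinRoot (artinSchreierPoly (p ^ u) f)) p :=
    charP_of_injective_algebraMap (algebraMap k _).injective p
  obtain ⟨m, -, hm⟩ := FiniteField.card K p
  have hB : ∀ c : K, c ^ p ^ (m : ℕ) = c := fun c => by rw [← hm, FiniteField.pow_card]
  have hBk : ∀ c : k, c ^ p ^ (m : ℕ) = c := fun c => by
    apply (algebraMap k K).injective
    rw [map_pow, hB]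
  have hq : 1 < p ^ u := Nat.one_lt_pow hu hp.out.one_lt
  have hB1 : 1 < p ^ (m : ℕ) := Nat.one_lt_pow m.pos.ne' hp.out.one_lt
  set A := AdjoinRoot (artinSchreierPoly (p ^ u) f)
  set x : A := AdjoinRoot.of _ X with hx
  set y : A := AdjoinRoot.root _ with hy
  set φ := coordHom hab
  have hφx : φ x = a := by rw [hx, coordHom_of, aeval_X]
  have hφy : φ y = b := coordHom_root hab
  have hxy : y ^ p ^ u - y = aeval x f := coordRing_equation
  set B := p ^ (m : ℕ) with hBdef
  set ϖ : A := x ^ B - x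
  set y₁ : A := y ^ B - y
  -- every element satisfies `n ^ B ≡ n` modulo `(ϖ, y₁)`
  have hJ : ∀ n : A, n ^ B - n ∈ Ideal.span {ϖ, y₁} := by
    intro n
    let J : Ideal A := Ideal.span {ϖ, y₁}
    have : (Ideal.Quotient.mk J).comp (iterateFrobenius A p m) = Ideal.Quotient.mk J := by
      refine coordRing_ringHom_ext (fun c => ?_) ?_ ?_
      · rw [RingHom.comp_apply, iterateFrobenius_def, ← map_pow, ← map_pow, hBk]
      · rw [RingHom.comp_apply, iterateFrobenius_def, Ideal.Quotient.eq]
        exact Ideal.subset_span (Set.mem_insert _ _)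
      · rw [RingHom.comp_apply, iterateFrobenius_def, Ideal.Quotient.eq]
        exact Ideal.subset_span (Set.mem_insert_of_mem _ rfl)
    have := congrArg (fun g => g n) this
    simp only [RingHom.comp_apply, iterateFrobenius_def] at this
    exact Ideal.Quotient.eq.1 this
  -- By additivity of Frobenius the left-hand side is f(x^B) - f(x), which x^B - x divides.
  have hγ : ∃ γ, y₁ ^ p ^ u - y₁ = ϖ * γ := by
    have h1 : y₁ ^ p ^ u - y₁ = aeval (x ^ B) f - aeval x f := by
      rw [aeval_pow_char_pow hBk, ← hxy]
      change (y ^ p ^ (m : ℕ) - y) ^ p ^ u - (y ^ p ^ (m : ℕ) - y) = _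
      rw [sub_pow_char_pow, sub_pow_char_pow, ← pow_mul, ← pow_mul, mul_comm]
      ring
    have h3 := sub_dvd_eval_sub (x ^ B) x (f.map (algebraMap k A))
    rw [eval_map_algebraMap, eval_map_algebraMap, ← h1] at h3
    exact h3
  obtain ⟨γ, hγ⟩ := hγ
  have hφ1 : φ y₁ = 0 := by simp only [y₁, map_sub, map_pow, hφy, hB, sub_self]
  refine ⟨ϖ, by simp only [ϖ, map_sub, map_pow, hφx, hB, sub_self], fun n hn => ?_⟩
  obtain ⟨α, β, hαβ⟩ := Ideal.mem_span_pair.1 (hJ n)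
  -- Both factors of `s` take the value -1 at the point. The second turns `n` into n^B - n = α ϖ + β
  -- y₁, and the first turns `y₁` into the multiple `ϖ * γ`.
  refine ⟨(y₁ ^ (p ^ u - 1) - 1) * (n ^ (B - 1) - 1), α * (y₁ ^ (p ^ u - 1) - 1) + β * γ, ?_, ?_⟩
  · rw [map_mul, map_sub, map_sub, map_pow, map_pow, hφ1, hn, zero_pow (by omega),
      zero_pow (by omega), map_one]
    norm_num
  · have e1 : y₁ ^ (p ^ u - 1) * y₁ = y₁ ^ p ^ u := pow_sub_one_mul (by omega) _
    have e2 : n ^ (B - 1) * n = n ^ B := pow_sub_one_mul (by omega) _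
    linear_combination (y₁ ^ (p ^ u - 1) - 1) * e2 - (y₁ ^ (p ^ u - 1) - 1) * hαβ + β * e1 + β * hγ

end FinitePlace

/-! ### Rational points: affine solutions and one point at infinity. -/

section PointCount

variable {k F K : Type*} [Field k] [Field F] [Algebra k F] [Field K] [Algebra k K]

theorem CurvePoint.eq_of_forall {P P' : CurvePoint k F K}
    (h : ∀ z (hz : z ∈ P.localRing), ∃ hz' : z ∈ P'.localRing,
      P.eval ⟨z, hz⟩ = P'.eval ⟨z, hz'⟩) (h' : P'.localRing ≤ P.localRing) : P = P' := by
  have hV : P.localRing = P'.localRing := le_antisymm (fun z hz => (h z hz).1) h'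
  obtain ⟨V, _, ev, _, _⟩ := P
  obtain ⟨V', _, ev', _, _⟩ := P'
  obtain rfl : V = V' := hV
  obtain rfl : ev = ev' := RingHom.ext fun z => (h z z.2).2
  rfl

theorem CurvePoint.eval_eq_zero (P : CurvePoint k F K) {z : F} (hz : z ∈ P.localRing)
    (hv : P.localRing.valuation z < 1) : P.eval ⟨z, hz⟩ = 0 := by
  by_contra h0
  have := (P.localRing.valuation_eq_one_iff ⟨z, hz⟩).1
    (P.isLocalHom_eval.map_nonunit _ (isUnit_iff_ne_zero.2 h0))
  exact hv.ne this

variable {p u : ℕ} [hp : Fact p.Prime] [CharP k p] {f : k[X]} {x y : F}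

theorem CurvePoint.isAtInfinity (P : CurvePoint k F K) (hx : x ∉ P.localRing) :
    IsAtInfinity k x P.localRing := ⟨P.algebraMap_mem, hx⟩

/-- The place is unique, and since its residue field is `k` the evaluation is forced. -/
theorem CurvePoint.eq_of_notMem {q : ℕ} (hF : IsFunctionFieldOf k F q f x y) (hq : 1 < q)
    (hd : f.natDegree ≠ 0) (hdq : f.natDegree.Coprime q) {P P' : CurvePoint k F K}
    (hP : x ∉ P.localRing) (hP' : x ∉ P'.localRing) : P = P' := by
  have hV : P.localRing = P'.localRing :=
    (P.isAtInfinity hP).unique hF hq hd hdq (P'.isAtInfinity hP')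
  refine CurvePoint.eq_of_forall (fun z hz => ⟨hV ▸ hz, ?_⟩) hV.ge
  obtain ⟨c, hc⟩ := (P.isAtInfinity hP).exists_valuation_sub_lt_one hF hq hd hdq hz
  have key : ∀ P : CurvePoint k F K, ∀ hz : z ∈ P.localRing,
      P.localRing.valuation (z - algebraMap k F c) < 1 →
      P.eval ⟨z, hz⟩ = algebraMap k K c := by
    intro P hz hc
    have hcm := P.algebraMap_mem c
    have h1 := P.eval_eq_zero (sub_mem hz hcm) hc
    rw [← P.eval_algebraMap c, ← sub_eq_zero, ← h1, ← map_sub]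
    rfl
  rw [key P hz hc, key P' (hV ▸ hz) (hV ▸ hc)]

theorem CurvePoint.exists_notMem {q : ℕ} (hF : IsFunctionFieldOf k F q f x y) (hq : 1 < q)
    (hd : f.natDegree ≠ 0) (hdq : f.natDegree.Coprime q) :
    ∃ P : CurvePoint k F K, x ∉ P.localRing := by
  obtain ⟨V, hV⟩ := IsAtInfinity.exists_of_transcendental hF.transcendental
  let i : k →+* V := (algebraMap k F).codRestrict V.toSubring hV.algebraMap_mem
  let r : k →+* IsLocalRing.ResidueField V := (IsLocalRing.residue V).comp i
  have hr : Function.Bijective r := by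
    refine ⟨r.injective, fun z => ?_⟩
    obtain ⟨⟨z, hz⟩, rfl⟩ := IsLocalRing.residue_surjective z
    obtain ⟨c, hc⟩ := hV.exists_valuation_sub_lt_one hF hq hd hdq hz
    refine ⟨c, ?_⟩
    symm
    rw [← sub_eq_zero, RingHom.comp_apply, ← map_sub, IsLocalRing.residue_eq_zero_iff,
      V.valuation_lt_one_iff]
    exact hc
  let e := RingEquiv.ofBijective r hr
  refine ⟨⟨V, hV.algebraMap_mem,
    ((algebraMap k K).comp e.symm.toRingHom).comp (IsLocalRing.residue V), ?_, ?_⟩, hV.notMem⟩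
  · refine ⟨fun z hz => ?_⟩
    rw [RingHom.comp_apply] at hz
    have h1 : IsLocalRing.residue V z ≠ 0 := fun h => hz.ne_zero (by rw [h, map_zero])
    exact (isUnit_iff_ne_zero.2 h1).of_map (IsLocalRing.residue V) z
  · intro a
    have : e.symm (IsLocalRing.residue V (i a)) = a := e.symm_apply_apply a
    exact congrArg (algebraMap k K) this

theorem CurvePoint.y_mem {q : ℕ} (hF : IsFunctionFieldOf k F q f x y) (hq : 1 < q)
    (P : CurvePoint k F K) (hx : x ∈ P.localRing) : y ∈ P.localRing := by
  by_contra hy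
  have h1 : aeval x f ∈ P.localRing := by
    rw [aeval_eq_sum_range]
    refine sum_mem fun i _ => ?_
    rw [Algebra.smul_def]
    exact mul_mem (P.algebraMap_mem _) (pow_mem hx _)
  rw [← hF.equation, ← ValuationSubring.valuation_le_one_iff, valuation_pow_sub_self hq hy] at h1
  refine h1.not_gt (one_lt_pow₀ ?_ (by omega))
  rwa [← not_le, ValuationSubring.valuation_le_one_iff]

theorem CurvePoint.eval_aeval (P : CurvePoint k F K) (hx : x ∈ P.localRing) (r : k[X])
    (hr : aeval x r ∈ P.localRing) : P.eval ⟨aeval x r, hr⟩ = aeval (P.eval ⟨x, hx⟩) r := by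
  let i : k →+* P.localRing := (algebraMap k F).codRestrict P.localRing.toSubring P.algebraMap_mem
  have h1 : (⟨aeval x r, hr⟩ : P.localRing) = eval₂ i ⟨x, hx⟩ r := by
    apply Subtype.ext
    change _ = P.localRing.subtype (eval₂ i ⟨x, hx⟩ r)
    rw [hom_eval₂]
    rfl
  rw [h1, hom_eval₂, aeval_def]
  congr 1
  exact RingHom.ext P.eval_algebraMap

theorem CurvePoint.equation {q : ℕ} (hF : IsFunctionFieldOf k F q f x y)
    (P : CurvePoint k F K) (hx : x ∈ P.localRing) (hy : y ∈ P.localRing) :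
    P.eval ⟨y, hy⟩ ^ q - P.eval ⟨y, hy⟩ = aeval (P.eval ⟨x, hx⟩) f := by
  have h1 : aeval x f ∈ P.localRing := by
    rw [← hF.equation]
    exact sub_mem (pow_mem hy _) hy
  rw [← P.eval_aeval hx f h1, ← map_pow, ← map_sub]
  congr 1
  exact Subtype.ext hF.equation

variable [Finite K]

/-- The points of the affine curve with values in a finite field are the solutions of the
equation. -/
theorem CurvePoint.existsUnique_affine (hF : IsFunctionFieldOf k F (p ^ u) f x y) (hu : u ≠ 0)
    (hd : f.natDegree ≠ 0) (hdq : f.natDegree.Coprime (p ^ u)) {a b : K}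
    (hab : b ^ p ^ u - b = aeval a f) :
    ∃! P : CurvePoint k F K, ∃ (hx : x ∈ P.localRing) (hy : y ∈ P.localRing),
      P.eval ⟨x, hx⟩ = a ∧ P.eval ⟨y, hy⟩ = b := by
  have hq : 1 < p ^ u := Nat.one_lt_pow hu hp.out.one_lt
  let A := AdjoinRoot (artinSchreierPoly (p ^ u) f)
  have hinj := coordHom_injective hF hq hd hdq
  have hdom : IsDomain A := hinj.isDomain
  let : Algebra A F := (coordHom hF.equation).toAlgebra
  have : FaithfulSMul A F := (faithfulSMul_iff_algebraMap_injective A F).2 hinj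
  have : IsFractionRing A F := by
    refine IsFractionRing.of_field A F fun z => ?_
    obtain ⟨R, S, rfl⟩ := exists_eq_evalPair_div hF z
    refine ⟨AdjoinRoot.mk _ R, AdjoinRoot.mk _ S, ?_⟩
    simp [A, RingHom.algebraMap_toAlgebra, coordHom]
  obtain ⟨ϖ, hϖ, hprin⟩ := coordHom_locally_principal hu hdom hab
  have hof : ∀ c, algebraMap A F (AdjoinRoot.of _ (C c)) = algebraMap k F c := fun c => by
    rw [RingHom.algebraMap_toAlgebra, coordHom_of, aeval_C]
  have hX : algebraMap A F (AdjoinRoot.of _ X) = x := by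
    rw [RingHom.algebraMap_toAlgebra, coordHom_of, aeval_X]
  have hY : algebraMap A F (AdjoinRoot.root _) = y := coordHom_root _
  obtain ⟨V, ev, h⟩ := exists_isLocalExtension (F := F) hϖ hprin
  have hmem : ∀ c, algebraMap k F c ∈ V := fun c => hof c ▸ h.mem _
  have heval : ∀ {z : F} (hz : z ∈ V) (n : A), algebraMap A F n = z →
      ev ⟨z, hz⟩ = coordHom hab n := by
    rintro z hz n rfl
    exact h.eval_eq n
  refine ⟨⟨V, hmem, ev, h.isLocalHom, fun c => ?_⟩, ⟨hX ▸ h.mem _, hY ▸ h.mem _, ?_, ?_⟩, ?_⟩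
  · rw [heval (hmem c) _ (hof c), coordHom_of, aeval_C]
  · exact (heval _ _ hX).trans (by rw [coordHom_of, aeval_X])
  · exact (heval _ _ hY).trans (coordHom_root _)
  · rintro P ⟨hx, hy, ha, hb⟩
    have hPm : ∀ n : A, algebraMap A F n ∈ P.localRing := by
      intro n
      obtain ⟨R, rfl⟩ := AdjoinRoot.mk_surjective n
      have : algebraMap A F (AdjoinRoot.mk _ R) = evalPair k x y R := by
        simp [A, RingHom.algebraMap_toAlgebra, coordHom]
      rw [this, coe_eval₂RingHom, eval₂_eq_sum_range]
      refine sum_mem fun i _ => mul_mem ?_ (pow_mem hy i)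
      change aeval x (R.coeff i) ∈ _
      rw [aeval_eq_sum_range]
      refine sum_mem fun j _ => ?_
      rw [Algebra.smul_def]
      exact mul_mem (P.algebraMap_mem _) (pow_mem hx _)
    -- Any point with these coordinates extends the same homomorphism on the coordinate ring, so it
    -- agrees with the constructed one.
    have hext : P.eval.comp ((algebraMap A F).codRestrict P.localRing.toSubring hPm) =
        coordHom hab := by
      refine coordRing_ringHom_ext (fun c => ?_) ?_ ?_
      · rw [coordHom_of, aeval_C, ← P.eval_algebraMap c]
        exact congrArg P.eval (Subtype.ext (hof c))
      · rw [coordHom_of, aeval_X, ← ha]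
        exact congrArg P.eval (Subtype.ext hX)
      · rw [coordHom_root, ← hb]
        exact congrArg P.eval (Subtype.ext hY)
    have h' : IsLocalExtension (coordHom hab) P.localRing P.eval :=
      ⟨hPm, P.isLocalHom_eval, fun n => congrArg (fun g => g n) hext⟩
    exact CurvePoint.eq_of_forall (fun z hz => h'.le hϖ hprin h hz)
      (fun z hz => (h.le hϖ hprin h' hz).1)

open Classical in
theorem natCard_curvePoint (hF : IsFunctionFieldOf k F (p ^ u) f x y) (hu : u ≠ 0)
    (hd : f.natDegree ≠ 0) (hdq : f.natDegree.Coprime (p ^ u)) :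
    Nat.card (CurvePoint k F K) =
      Nat.card {c : K × K // c.2 ^ p ^ u - c.2 = aeval c.1 f} + 1 := by
  have hq : 1 < p ^ u := Nat.one_lt_pow hu hp.out.one_lt
  let g : CurvePoint k F K → Option {c : K × K // c.2 ^ p ^ u - c.2 = aeval c.1 f} := fun P =>
    if hx : x ∈ P.localRing then
      some ⟨(P.eval ⟨x, hx⟩, P.eval ⟨y, P.y_mem hF hq hx⟩), P.equation hF hx _⟩
    else none
  have hg : Function.Bijective g := by
    constructor
    · intro P P' h
      by_cases hx : x ∈ P.localRing <;> by_cases hx' : x ∈ P'.localRing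
      · simp only [g, dif_pos hx, dif_pos hx', Option.some.injEq, Subtype.mk.injEq,
          Prod.mk.injEq] at h
        exact (CurvePoint.existsUnique_affine hF hu hd hdq
          (P'.equation hF hx' (P'.y_mem hF hq hx'))).unique ⟨hx, P.y_mem hF hq hx, h⟩
          ⟨hx', P'.y_mem hF hq hx', rfl, rfl⟩
      · simp [g, hx, hx'] at h
      · simp [g, hx, hx'] at h
      · exact CurvePoint.eq_of_notMem hF hq hd hdq hx hx'
    · rintro (_ | ⟨⟨a, b⟩, hab⟩)
      · obtain ⟨P, hP⟩ := CurvePoint.exists_notMem (K := K) hF hq hd hdq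
        exact ⟨P, dif_neg hP⟩
      · obtain ⟨P, ⟨hx, hy, ha, hb⟩, -⟩ := CurvePoint.existsUnique_affine hF hu hd hdq hab
        refine ⟨P, ?_⟩
        simp only [g, dif_pos hx, ha, hb]
  rw [Nat.card_congr (Equiv.ofBijective g hg), Finite.card_option]

end PointCount

/-! ### Sums over orbit representatives. -/

section Orbits

variable {α : Type*} [DecidableEq α] {F : α → α}

theorem image_eq_of_mapsTo (hF : F.Injective) {T : Finset α} (hT : ∀ c ∈ T, F c ∈ T) :
    T.image F = T :=
  Finset.eq_of_subset_of_card_le (Finset.image_subset_iff.2 hT)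
    (Finset.card_image_of_injective T hF).ge

theorem sum_comp_of_mapsTo {M : Type*} [AddCommMonoid M] (hF : F.Injective) {T : Finset α}
    (hT : ∀ c ∈ T, F c ∈ T) (φ : α → M) : ∑ c ∈ T, φ (F c) = ∑ c ∈ T, φ c := by
  conv_rhs => rw [← image_eq_of_mapsTo hF hT, Finset.sum_image fun _ _ _ _ h => hF h]

theorem minimalPeriod_pos_of_mapsTo (hF : F.Injective) {T : Finset α} (hT : ∀ c ∈ T, F c ∈ T)
    {c : α} (hc : c ∈ T) : 0 < Function.minimalPeriod F c := by
  refine minimalPeriod_pos_of_mem (M := T.val) hF ?_ hc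
  conv_rhs => rw [← image_eq_of_mapsTo hF hT]
  rw [Finset.image_val, Multiset.dedup_eq_self.2]
  exact T.nodup.map hF

/-- A sum over a finite set that is stable under an injective map is a sum over representatives of
the orbits. -/
theorem exists_orbit_transversal (hF : F.Injective) (T : Finset α) (hT : ∀ c ∈ T, F c ∈ T) :
    ∃ R ⊆ T, ∀ φ : α → ℂ, (∀ c ∈ T, φ (F c) = φ c) →
      ∑ c ∈ T, φ c = ∑ r ∈ R, (Function.minimalPeriod F r : ℂ) * φ r := by
  induction T using Finset.strongInduction with
  | _ T ih =>
    rcases T.eq_empty_or_nonempty with rfl | ⟨c, hc⟩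
    · exact ⟨∅, subset_rfl, by simp⟩
    have hm := minimalPeriod_pos_of_mapsTo hF hT hc
    let O : Finset α := (Finset.range (Function.minimalPeriod F c)).image fun i => F^[i] c
    have hiter : ∀ i, F^[i] c ∈ T := fun i => by
      induction i with
      | zero => exact hc
      | succ i ih => rw [Function.iterate_succ_apply']; exact hT _ ih
    have hOT : O ⊆ T := Finset.image_subset_iff.2 fun i _ => hiter i
    have hOmem : ∀ i, F^[i] c ∈ O := fun i => by
      rw [← Function.iterate_mod_minimalPeriod_eq]
      exact Finset.mem_image_of_mem _ (Finset.mem_range.2 (Nat.mod_lt _ hm))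
    have hcO : c ∈ O := hOmem 0
    -- `F` permutes the orbit `O`, so the complement of `O` in `T` is stable too and the induction
    -- applies to it.
    have hO : ∀ b, F b ∈ O → b ∈ O := by
      intro b hb
      have h1 : O.image F = O := by
        refine image_eq_of_mapsTo hF fun b hb => ?_
        obtain ⟨i, -, rfl⟩ := Finset.mem_image.1 hb
        rw [← Function.iterate_succ_apply' F]
        exact hOmem _
      rw [← h1] at hb
      obtain ⟨b', hb', h⟩ := Finset.mem_image.1 hb
      rwa [← hF h]
    have hinj : Set.InjOn (fun i => F^[i] c) (Finset.range (Function.minimalPeriod F c)) := by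
      have := Function.iterate_injOn_Iio_minimalPeriod (f := F) (x := c)
      rwa [Finset.coe_range]
    obtain ⟨R, hR, h⟩ := ih (T \ O)
      (Finset.sdiff_ssubset hOT ⟨c, hcO⟩) (fun b hb => by
        rw [Finset.mem_sdiff] at hb ⊢
        exact ⟨hT b hb.1, fun h => hb.2 (hO b h)⟩)
    have hcR : c ∉ R := fun h => (Finset.mem_sdiff.1 (hR h)).2 hcO
    refine ⟨insert c R, Finset.insert_subset hc (hR.trans Finset.sdiff_subset), fun φ hφ => ?_⟩
    rw [Finset.sum_insert hcR, ← h φ fun b hb => hφ b (Finset.mem_sdiff.1 hb).1,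
      ← Finset.sum_sdiff hOT, add_comm, Finset.sum_image hinj]
    congr 1
    have : ∀ i, φ (F^[i] c) = φ c := fun i => by
      induction i with
      | zero => rfl
      | succ i ih => rw [Function.iterate_succ_apply', hφ _ (hiter i), ih]
    simp [this]

end Orbits

/-! ### Logarithmic derivatives of power series. -/

section LogDerivative

/-- `W` is the logarithmic derivative `X L' / L` of the power series `L`. -/
def HasLogDeriv {R : Type*} [CommRing R] (L W : PowerSeries R) : Prop :=
  PowerSeries.X * PowerSeries.derivative R L = L * W

namespace HasLogDeriv

variable {R : Type*} [CommRing R] {L L' W W' : PowerSeries R}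

theorem coeff_X_mul_derivative (L : PowerSeries R) (n : ℕ) :
    PowerSeries.coeff n (PowerSeries.X * PowerSeries.derivative R L) =
      n * PowerSeries.coeff n L := by
  cases n with
  | zero => simp
  | succ n =>
    rw [PowerSeries.coeff_succ_X_mul, PowerSeries.coeff_derivative, mul_comm]
    push_cast
    rfl

theorem iff_coeff : HasLogDeriv L W ↔
    ∀ n : ℕ, n * PowerSeries.coeff n L = PowerSeries.coeff n (L * W) := by
  rw [HasLogDeriv, PowerSeries.ext_iff]
  simp_rw [coeff_X_mul_derivative]

theorem one : HasLogDeriv (1 : PowerSeries R) 0 := by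
  simp [HasLogDeriv]

theorem mul (h : HasLogDeriv L W) (h' : HasLogDeriv L' W') :
    HasLogDeriv (L * L') (W + W') := by
  rw [HasLogDeriv] at *
  rw [Derivation.leibniz, smul_eq_mul, smul_eq_mul]
  linear_combination L' * h + L * h'

theorem prod {ι : Type*} (s : Finset ι) {L W : ι → PowerSeries R}
    (h : ∀ i ∈ s, HasLogDeriv (L i) (W i)) : HasLogDeriv (∏ i ∈ s, L i) (∑ i ∈ s, W i) := by
  classical
  induction s using Finset.induction_on with
  | empty => simpa using one
  | insert i s hi ih =>
    rw [Finset.prod_insert hi, Finset.sum_insert hi]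
    exact (h i (Finset.mem_insert_self i s)).mul
      (ih fun j hj => h j (Finset.mem_insert_of_mem hj))

theorem expand (h : HasLogDeriv L W) {m : ℕ} (hm : m ≠ 0) :
    HasLogDeriv (PowerSeries.expand m hm L) ((m : PowerSeries R) * PowerSeries.expand m hm W) := by
  rw [iff_coeff] at *
  intro n
  rw [mul_left_comm, ← map_mul, ← nsmul_eq_mul (α := PowerSeries R), map_nsmul,
    PowerSeries.coeff_expand, PowerSeries.coeff_expand]
  split_ifs with hmn
  · obtain ⟨k, rfl⟩ := hmn
    rw [Nat.mul_div_cancel_left _ (Nat.pos_of_ne_zero hm), ← h, nsmul_eq_mul]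
    push_cast
    ring
  · simp

/-- As `W` has no constant term, n L_n is determined by the earlier coefficients, and `n` can be
cancelled in characteristic zero. -/
theorem unique {L L' W : PowerSeries ℂ} (h : HasLogDeriv L W) (h' : HasLogDeriv L' W)
    (hW : PowerSeries.coeff 0 W = 0) (h0 : PowerSeries.coeff 0 L = PowerSeries.coeff 0 L') :
    L = L' := by
  ext n
  induction n using Nat.strong_induction_on with
  | _ n ih =>
    rcases Nat.eq_zero_or_pos n with rfl | hn
    · exact h0
    have hn' : (n : ℂ) ≠ 0 := Nat.cast_ne_zero.2 hn.ne'
    apply mul_left_cancel₀ hn'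
    rw [iff_coeff.1 h, iff_coeff.1 h', PowerSeries.coeff_mul, PowerSeries.coeff_mul]
    refine Finset.sum_congr rfl fun x hx => ?_
    rw [Finset.HasAntidiagonal.mem_antidiagonal] at hx
    rcases Nat.eq_zero_or_pos x.2 with h2 | h2
    · rw [h2, hW, mul_zero, mul_zero]
    · rw [ih x.1 (by omega)]

end HasLogDeriv

end LogDerivative

/-! ### Product of the L-polynomials over Frobenius orbits. -/

section ZetaFunction

variable (p : ℕ) [hp : Fact p.Prime] {E : Type*} [Field E] [CharP E p]

/-- The exponential sum of `c g` over the field fixed by the `N`-th power of Frobenius. -/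
noncomputable def exponentialSum (ψ : AddChar E ℂ) (g : E[X]) (N : ℕ) (c : E) : ℂ :=
  ∑ a ∈ frobFixed p E N, ψ (frobTrace p N (c * g.eval a))

/-- Substituting a^(p^s) for `a` permutes the field and replaces c g(a) by its Frobenius conjugate,
which has the same trace. The sums are therefore constant on orbits of `c`. -/
theorem exponentialSum_iterateFrobenius {ψ : AddChar E ℂ} {g : E[X]} {s : ℕ}
    (hg : g.map (iterateFrobenius E p s) = g) {n : ℕ} (hsn : s * n ≠ 0) {c : E}
    (hc : c ∈ frobFixed p E (s * n)) :
    exponentialSum p ψ g (s * n) (iterateFrobenius E p s c) = exponentialSum p ψ g (s * n) c := by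
  classical
  have hfix : ∀ a ∈ frobFixed p E (s * n), iterateFrobenius E p s a ∈ frobFixed p E (s * n) := by
    intro a ha
    rw [mem_frobFixed p hsn] at ha ⊢
    rw [iterateFrobenius_def, pow_pow_comm_of_fixed p ha]
  rw [exponentialSum, ← sum_comp_of_mapsTo (iterateFrobenius_injective p s) hfix]
  refine Finset.sum_congr rfl fun a ha => ?_
  have h1 := eval_iterateFrobenius p hg a 1
  have h2 := eval_iterateFrobenius p hg a n
  rw [mem_frobFixed p hsn] at hc ha
  rw [iterate_iterateFrobenius, ha] at h2
  rw [Function.iterate_one, mul_one] at h1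
  rw [h1, iterateFrobenius_def, ← mul_pow, frobTrace_pow_pow]
  rw [mul_pow, hc, ← h2]

variable [IsAlgClosed E] [DecidableEq E]

/-- The power series with the logarithmic derivative given by the sums of the exponential sums of
`c g` over the nonzero `c` with `c ^ (p ^ u) = c` is a polynomial of degree at most
`(p ^ u - 1) (deg g - 1)` with integral coefficients. -/
theorem exists_polynomial_hasLogDeriv {ψ : AddChar E ℂ} (hψ : ∀ x, x ^ p = x → ψ x = 1 → x = 0)
    {g : E[X]} {s u : ℕ} (hs : s ≠ 0) (hu : u ≠ 0) (hg : g.map (iterateFrobenius E p s) = g)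
    (hd : g.natDegree.Coprime p) :
    ∃ L : ℂ[X], L.natDegree ≤ (p ^ u - 1) * (g.natDegree - 1) ∧ L.coeff 0 = 1 ∧
      (∀ i, IsIntegral ℤ (L.coeff i)) ∧
      HasLogDeriv (L : PowerSeries ℂ) (PowerSeries.mk fun n => if n = 0 then 0 else
        ∑ c ∈ ((frobFixed p E u).filter (· ∈ frobFixed p E (s * n))).erase 0,
          exponentialSum p ψ g (s * n) c) := by
  let F := iterateFrobenius E p s
  have hF : Function.Injective F := iterateFrobenius_injective p s
  let T := (frobFixed p E u).erase 0
  have hT : ∀ c ∈ T, F c ∈ T := by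
    intro c hc
    rw [Finset.mem_erase, mem_frobFixed p hu] at hc ⊢
    refine ⟨(map_ne_zero_iff F hF).2 hc.1, ?_⟩
    change (c ^ p ^ s) ^ _ = c ^ p ^ s
    exact pow_pow_comm_of_fixed p hc.2 _
  have hTcard : T.card = p ^ u - 1 := by
    rw [Finset.card_erase_of_mem, card_frobFixed p hu]
    rw [mem_frobFixed p hu, zero_pow (pow_ne_zero _ hp.out.ne_zero)]
  obtain ⟨R, hRT, hR⟩ := exists_orbit_transversal hF T hT
  let m : E → ℕ := Function.minimalPeriod F
  have hm : ∀ r ∈ R, m r ≠ 0 := fun r hr => (minimalPeriod_pos_of_mapsTo hF hT (hRT hr)).ne'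
  -- The period of `r` is the degree over 𝔽_{p^s} of the field it generates, so `r` enters the sum
  -- only for multiples of `m r`.
  have hdvd : ∀ r n, n ≠ 0 → (m r ∣ n ↔ r ∈ frobFixed p E (s * n)) := fun r n hn => by
    rw [mem_frobFixed p (mul_ne_zero hs hn), ← iterate_iterateFrobenius]
    exact Function.isPeriodicPt_iff_minimalPeriod_dvd.symm
  have hdeg : ∀ r ∈ R, (C r * g).natDegree = g.natDegree := fun r hr =>
    natDegree_C_mul (Finset.mem_erase.1 (hRT hr)).1
  have hL : ∀ r ∈ R, ∃ L : ℂ[X], L.natDegree ≤ g.natDegree - 1 ∧ L.coeff 0 = 1 ∧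
      (∀ i, IsIntegral ℤ (L.coeff i)) ∧ ∀ n : ℕ, (n : ℂ) * L.coeff n = ∑ j ∈ Finset.Icc 1 n,
        exponentialSum p ψ g (s * m r * j) r * L.coeff (n - j) := by
    intro r hr
    have hfix : (C r * g).map (iterateFrobenius E p (s * m r)) = C r * g := by
      have hgm : ∀ n, g.map (iterateFrobenius E p (s * n)) = g := by
        intro n
        induction n with
        | zero => simp
        | succ n ih =>
          rw [Nat.mul_succ, iterateFrobenius_add, ← Polynomial.map_map, hg, ih]
      rw [Polynomial.map_mul, hgm, map_C, iterateFrobenius_def,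
        (mem_frobFixed p (mul_ne_zero hs (hm r hr))).1 ((hdvd r _ (hm r hr)).1 dvd_rfl)]
    obtain ⟨L, h1, h2, h3, h4⟩ := exists_exponentialSum_lPolynomial p (mul_ne_zero hs (hm r hr))
      hfix (by rwa [hdeg r hr]) hψ
    refine ⟨L, by rwa [hdeg r hr] at h1, h2, h3, fun n => ?_⟩
    simpa [exponentialSum] using h4 n
  choose! L hL1 hL2 hL3 hL4 using hL
  -- `L r` is taken over the extension of degree `m r`, hence the substitution of T^(m r) for T. The
  -- orbit lengths add up to p^u - 1, which gives the degree bound.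
  let P : ℂ[X] := ∏ r ∈ R, Polynomial.expand ℂ (m r) (L r)
  refine ⟨P, ?_, ?_, ?_, ?_⟩
  · have hsum : (p ^ u - 1) * (g.natDegree - 1) = ∑ r ∈ R, m r * (g.natDegree - 1) := by
      have := hR (fun _ => 1) (fun _ _ => rfl)
      simp only [mul_one, Finset.sum_const, nsmul_eq_mul, hTcard] at this
      rw [← Finset.sum_mul]
      congr 1
      exact_mod_cast this
    rw [hsum]
    refine (natDegree_prod_le _ _).trans (Finset.sum_le_sum fun r hr => ?_)
    rw [natDegree_expand, mul_comm]
    exact Nat.mul_le_mul_left _ (hL1 r hr)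
  · rw [coeff_zero_eq_eval_zero, eval_prod]
    refine Finset.prod_eq_one fun r hr => ?_
    rw [← coeff_zero_eq_eval_zero, ← hL2 r hr]
    simpa using coeff_expand_mul (Nat.pos_of_ne_zero (hm r hr)) (L r) 0
  · have hmem : P ∈ Polynomial.lifts (integralClosure ℤ ℂ).val.toRingHom := by
      refine prod_mem fun r hr => ?_
      rw [Polynomial.lifts_iff_coeff_lifts]
      intro n
      rw [coeff_expand (Nat.pos_of_ne_zero (hm r hr))]
      split_ifs
      · exact ⟨⟨_, hL3 r hr _⟩, rfl⟩
      · exact ⟨0, map_zero _⟩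
    intro i
    rw [Polynomial.lifts_iff_coeff_lifts] at hmem
    obtain ⟨z, hz⟩ := hmem i
    rw [← hz]
    exact z.2
  · let W : E → PowerSeries ℂ := fun r =>
      PowerSeries.mk fun n => if m r ∣ n ∧ n ≠ 0 then m r * exponentialSum p ψ g (s * n) r else 0
    have hW : ∀ r ∈ R, HasLogDeriv ((Polynomial.expand ℂ (m r) (L r) : ℂ[X]) : PowerSeries ℂ)
        (W r) := by
      intro r hr
      have h1 : HasLogDeriv (L r : PowerSeries ℂ) (PowerSeries.mk fun j => if j = 0 then 0 else
          exponentialSum p ψ g (s * m r * j) r) := by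
        rw [HasLogDeriv.iff_coeff]
        intro n
        rw [Polynomial.coeff_coe, hL4 r hr, mul_comm (L r : PowerSeries ℂ), PowerSeries.coeff_mul,
          Finset.Nat.sum_antidiagonal_eq_sum_range_succ_mk, Finset.sum_range_succ']
        simp only [PowerSeries.coeff_mk, if_true, zero_mul, add_zero, Polynomial.coeff_coe,
          Nat.succ_ne_zero, if_false]
        rw [Finset.range_eq_Ico, Finset.sum_Ico_add' (fun j =>
          exponentialSum p ψ g (s * m r * j) r * (L r).coeff (n - j)) 0 n 1]
        rfl
      have h2 := h1.expand (hm r hr)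
      have e1 : PowerSeries.expand (m r) (hm r hr) (L r : PowerSeries ℂ) =
          ((Polynomial.expand ℂ (m r) (L r) : ℂ[X]) : PowerSeries ℂ) := by
        ext n
        rw [PowerSeries.coeff_expand, Polynomial.coeff_coe, Polynomial.coeff_coe,
          Polynomial.coeff_expand (Nat.pos_of_ne_zero (hm r hr))]
      have e2 : ((m r : ℕ) : PowerSeries ℂ) * PowerSeries.expand (m r) (hm r hr)
          (PowerSeries.mk fun j => if j = 0 then 0 else exponentialSum p ψ g (s * m r * j) r) =
          W r := by
        ext n
        rw [← nsmul_eq_mul, map_nsmul, PowerSeries.coeff_expand]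
        by_cases hn : m r ∣ n
        · obtain ⟨j, rfl⟩ := hn
          rw [if_pos (dvd_mul_right _ _), PowerSeries.coeff_mk,
            Nat.mul_div_cancel_left _ (Nat.pos_of_ne_zero (hm r hr))]
          by_cases hj : j = 0
          · simp [hj, W]
          · rw [if_neg hj, PowerSeries.coeff_mk, if_pos ⟨dvd_mul_right _ _, mul_ne_zero (hm r hr) hj⟩,
              nsmul_eq_mul, mul_assoc s]
        · simp [W, hn]
      rwa [e1, e2] at h2
    have hP := HasLogDeriv.prod R hW
    have e3 : ((P : ℂ[X]) : PowerSeries ℂ) =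
        ∏ r ∈ R, ((Polynomial.expand ℂ (m r) (L r) : ℂ[X]) : PowerSeries ℂ) := by
      exact map_prod (Polynomial.coeToPowerSeries.ringHom (R := ℂ)) _ _
    rw [e3]
    convert hP using 1
    ext n
    rw [PowerSeries.coeff_mk, map_sum]
    simp only [W, PowerSeries.coeff_mk]
    by_cases hn : n = 0
    · simp [hn]
    rw [if_neg hn]
    -- Extension by zero gives a function constant on the orbits in `T`; the factor `m r` in `W r`
    -- is the length of the orbit.
    let φ : E → ℂ := fun c =>
      if c ∈ frobFixed p E (s * n) then exponentialSum p ψ g (s * n) c else 0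
    have hφ : ∀ c ∈ T, φ (F c) = φ c := by
      intro c hc
      have hmem : F c ∈ frobFixed p E (s * n) ↔ c ∈ frobFixed p E (s * n) := by
        rw [mem_frobFixed p (mul_ne_zero hs hn), mem_frobFixed p (mul_ne_zero hs hn), ← map_pow,
          hF.eq_iff]
      by_cases h : c ∈ frobFixed p E (s * n)
      · simp only [φ, if_pos h, if_pos (hmem.2 h)]
        exact exponentialSum_iterateFrobenius p hg (mul_ne_zero hs hn) h
      · simp only [φ, if_neg h, if_neg (mt hmem.1 h)]
    have e4 : ((frobFixed p E u).filter (· ∈ frobFixed p E (s * n))).erase 0 =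
        T.filter (· ∈ frobFixed p E (s * n)) := by
      ext c
      simp only [T, Finset.mem_erase, Finset.mem_filter]
      tauto
    rw [e4, Finset.sum_filter, hR φ hφ]
    refine Finset.sum_congr rfl fun r hr => ?_
    simp only [φ, ← hdvd r n hn, hn, ne_eq, not_false_eq_true, and_true]
    split_ifs
    · rfl
    · exact mul_zero _

end ZetaFunction

/-! ### Point counts as exponential sums. -/

section CurveCount

variable {p : ℕ} [hp : Fact p.Prime]

theorem pow_natCard_of_finite {K : Type*} [Field K] [Finite K] (a : K) : a ^ Nat.card K = a := by
  have := Fintype.ofFinite K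
  rw [Nat.card_eq_fintype_card, FiniteField.pow_card]

theorem map_iterateFrobenius_of_natCard {k : Type*} [Field k] [Finite k] {s : ℕ} (hk : Nat.card k = p ^ s) {E : Type*} [Field E]
    [Algebra k E] [CharP E p] (f : k[X]) :
    (f.map (algebraMap k E)).map (iterateFrobenius E p s) = f.map (algebraMap k E) := by
  rw [Polynomial.map_map]
  congr 1
  ext c
  rw [RingHom.comp_apply, iterateFrobenius_def, ← map_pow, ← hk, pow_natCard_of_finite]

open Classical in
/-- The solutions of the equation in a finite extension of degree `n` of `k`, counted in an
algebraically closed field. -/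
theorem natCard_affine_eq_sum {k : Type*} [Field k] {s u n : ℕ} (hn : s * n ≠ 0)
    {K E : Type*} [Field K] [Algebra k K]
    [Finite K] (hK : Nat.card K = p ^ (s * n)) [Field E] [Algebra k E] [CharP E p] [IsAlgClosed E]
    (f : k[X]) :
    Nat.card {c : K × K // c.2 ^ p ^ u - c.2 = aeval c.1 f} =
      ∑ a ∈ frobFixed p E (s * n), ((frobFixed p E (s * n)).filter fun b =>
        b ^ p ^ u - b = (f.map (algebraMap k E)).eval a).card := by
  have := Fintype.ofFinite K
  have : Algebra.IsAlgebraic k K := Algebra.IsAlgebraic.of_finite k K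
  let j : K →ₐ[k] E := IsAlgClosed.lift
  have hji : Function.Injective j := j.toRingHom.injective
  have hj : ∀ a, j a ∈ frobFixed p E (s * n) := fun a => by
    rw [mem_frobFixed p hn, ← map_pow, ← hK, pow_natCard_of_finite]
  have hsurj : ∀ b ∈ frobFixed p E (s * n), ∃ a, j a = b := by
    have : Finset.univ.image j = frobFixed p E (s * n) := by
      refine Finset.eq_of_subset_of_card_le (Finset.image_subset_iff.2 fun a _ => hj a) ?_
      rw [Finset.card_image_of_injective _ hji, card_frobFixed p hn, ← hK,
        Nat.card_eq_fintype_card]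
      rfl
    intro b hb
    rw [← this] at hb
    obtain ⟨a, -, h⟩ := Finset.mem_image.1 hb
    exact ⟨a, h⟩
  have heq : ∀ a b, j b ^ p ^ u - j b = (f.map (algebraMap k E)).eval (j a) ↔
      b ^ p ^ u - b = aeval a f := fun a b => by
    rw [eval_map_algebraMap, aeval_algHom_apply, ← map_pow, ← map_sub, hji.eq_iff]
  rw [Nat.card_eq_fintype_card, Fintype.card_subtype, ← Finset.card_sigma]
  refine Finset.card_bij (fun c _ => ⟨j c.1, j c.2⟩) ?_ ?_ ?_
  · rintro ⟨a, b⟩ h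
    simp only [Finset.mem_filter, Finset.mem_univ, true_and] at h
    simp only [Finset.mem_sigma, Finset.mem_filter, hj, true_and]
    exact (heq a b).2 h
  · rintro ⟨a, b⟩ _ ⟨a', b'⟩ _ h
    simp only [Sigma.mk.injEq, heq_eq_eq] at h
    rw [hji h.1, hji h.2]
  · rintro ⟨a, b⟩ h
    simp only [Finset.mem_sigma, Finset.mem_filter] at h
    obtain ⟨a, rfl⟩ := hsurj a h.1
    obtain ⟨b, rfl⟩ := hsurj b h.2.1
    exact ⟨(a, b), by simpa using (heq a b).1 h.2.2, rfl⟩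

variable {k F : Type*} [Field k] [Finite k] [Field F] [Algebra k F] [CharP k p]

/-- Summing the character count of the fibres over the abscissa gives the affine points. The term `c
= 0` is Q^n, and the point at infinity accounts for the 1. -/
theorem numPoints_sub_eq_sum_exponentialSum {s u : ℕ} (hk : Nat.card k = p ^ s) (hu : u ≠ 0)
    {f : k[X]} (hd : f.natDegree.Coprime p) {x y : F} (hF : IsFunctionFieldOf k F (p ^ u) f x y)
    {E : Type*} [Field E] [Algebra k E] [CharP E p] [IsAlgClosed E] [DecidableEq E]
    {ψ : AddChar E ℂ} (hψ : ∀ x, x ^ p = x → ψ x = 1 → x = 0) (n : ℕ) [NeZero n] :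
    (numPoints k F p n : ℂ) - (p ^ s) ^ n - 1 =
      ∑ c ∈ ((frobFixed p E u).filter (· ∈ frobFixed p E (s * n))).erase 0,
        exponentialSum p ψ (f.map (algebraMap k E)) (s * n) c := by
  have hs : s ≠ 0 := by
    rintro rfl
    exact (Finite.one_lt_card (α := k)).ne' hk
  have hn := NeZero.ne n
  have hsn := mul_ne_zero hs hn
  have hd0 : f.natDegree ≠ 0 := fun h => by
    rw [h, Nat.coprime_zero_left] at hd
    exact hp.out.ne_one hd
  have hK : Nat.card (FiniteField.Extension k p n) = p ^ (s * n) := by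
    rw [FiniteField.natCard_extension, hk, pow_mul]
  have hmem : ∀ a ∈ frobFixed p E (s * n),
      (f.map (algebraMap k E)).eval a ∈ frobFixed p E (s * n) := by
    intro a ha
    have h := eval_iterateFrobenius p (map_iterateFrobenius_of_natCard hk (E := E) f) a n
    rw [mem_frobFixed p hsn] at ha ⊢
    rw [iterate_iterateFrobenius, ha] at h
    exact h.symm
  have h0 : (0 : E) ∈ (frobFixed p E u).filter (· ∈ frobFixed p E (s * n)) := by
    rw [Finset.mem_filter, mem_frobFixed p hu, mem_frobFixed p hsn,
      zero_pow (pow_ne_zero _ hp.out.ne_zero), zero_pow (pow_ne_zero _ hp.out.ne_zero)]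
    exact ⟨rfl, rfl⟩
  have hcount : (numPoints k F p n : ℂ) =
      ∑ c ∈ (frobFixed p E u).filter (· ∈ frobFixed p E (s * n)),
        exponentialSum p ψ (f.map (algebraMap k E)) (s * n) c + 1 := by
    classical
    rw [numPoints, natCard_curvePoint hF hu hd0 (hd.pow_right u), natCard_affine_eq_sum hsn hK
      (E := E) f]
    push_cast
    simp only [exponentialSum]
    rw [Finset.sum_comm]
    congr 1
    refine Finset.sum_congr rfl fun a ha => ?_
    rw [← card_filter_artinSchreier p hu hsn hψ (hmem a ha)]
    congr!
  have hzero : exponentialSum p ψ (f.map (algebraMap k E)) (s * n) 0 = (p ^ s) ^ n := by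
    simp [exponentialSum, card_frobFixed p hsn, pow_mul]
  rw [hcount, ← Finset.add_sum_erase _ _ h0, hzero]
  ring

end CurveCount

/-! ### The L-series is an integral polynomial. -/

section LSeries

theorem HasLogDeriv.map {R S : Type*} [CommRing R] [CommRing S] (φ : R →+* S)
    {L W : PowerSeries R} (h : HasLogDeriv L W) :
    HasLogDeriv (PowerSeries.map φ L) (PowerSeries.map φ W) := by
  rw [HasLogDeriv.iff_coeff] at *
  intro n
  rw [← map_mul, PowerSeries.coeff_map, PowerSeries.coeff_map, ← h, map_mul, map_natCast]

variable (k F : Type*) [Field k] [Finite k] [Field F] [Algebra k F] (p : ℕ) [hp : Fact p.Prime]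
  [CharP k p]

theorem constantCoeff_logLSeries : PowerSeries.constantCoeff (logLSeries k F p) = 0 := by
  rw [← PowerSeries.coeff_zero_eq_constantCoeff_apply]
  simp [logLSeries]

theorem coeff_zero_curveLSeries : PowerSeries.coeff 0 (curveLSeries k F p) = 1 := by
  have h := constantCoeff_logLSeries k F p
  rw [PowerSeries.coeff_zero_eq_constantCoeff_apply, curveLSeries]
  refine (PowerSeries.constantCoeff_subst (PowerSeries.HasSubst.of_constantCoeff_zero' h) _).trans ?_
  rw [finsum_eq_single _ 0]
  · simp
  · intro n hn
    change _ • PowerSeries.constantCoeff _ = _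
    rw [map_pow, h, zero_pow hn, smul_zero]

theorem hasLogDeriv_curveLSeries : HasLogDeriv (curveLSeries k F p) (PowerSeries.mk fun n =>
    (n : ℚ) * PowerSeries.coeff n (logLSeries k F p)) := by
  have h := constantCoeff_logLSeries k F p
  have e : (PowerSeries.mk fun n => (n : ℚ) * PowerSeries.coeff n (logLSeries k F p)) =
      PowerSeries.X * PowerSeries.derivative ℚ (logLSeries k F p) := by
    ext n
    rw [HasLogDeriv.coeff_X_mul_derivative, PowerSeries.coeff_mk]
  rw [e, HasLogDeriv, curveLSeries,
    PowerSeries.derivative_subst (PowerSeries.HasSubst.of_constantCoeff_zero' h),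
    PowerSeries.derivative_exp]
  ring

theorem natCast_mul_coeff_logLSeries (n : ℕ) [NeZero n] :
    (n : ℚ) * PowerSeries.coeff n (logLSeries k F p) =
      (numPoints k F p n : ℚ) - (Nat.card k : ℚ) ^ n - 1 := by
  obtain ⟨j, rfl⟩ := Nat.exists_eq_succ_of_ne_zero (NeZero.ne n)
  rw [logLSeries, PowerSeries.coeff_mk]
  exact mul_div_cancel₀ _ (Nat.cast_ne_zero.2 (Nat.succ_ne_zero j))

variable {k F p}

/-- The `L`-series is a polynomial with integral coefficients of degree at most
`(q - 1) (d - 1)`. -/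
theorem exists_int_coeff_curveLSeries {s u : ℕ} (hk : Nat.card k = p ^ s) (hu : u ≠ 0)
    {f : k[X]} (hd : f.natDegree.Coprime p) {x y : F}
    (hF : IsFunctionFieldOf k F (p ^ u) f x y) :
    ∃ z : ℕ → ℤ, (∀ i, (z i : ℚ) = PowerSeries.coeff i (curveLSeries k F p)) ∧
      ∀ i, (p ^ u - 1) * (f.natDegree - 1) < i → z i = 0 := by
  classical
  have hs : s ≠ 0 := by
    rintro rfl
    exact (Finite.one_lt_card (α := k)).ne' hk
  let E := AlgebraicClosure k
  have : CharP E p := charP_of_injective_algebraMap (algebraMap k E).injective p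
  obtain ⟨ψ, hψ⟩ := exists_addChar p E
  have hdeg : (f.map (algebraMap k E)).natDegree = f.natDegree := natDegree_map _
  obtain ⟨L, h1, h2, h3, h4⟩ := exists_polynomial_hasLogDeriv p hψ hs hu
    (map_iterateFrobenius_of_natCard hk (E := E) f) (by rwa [hdeg])
  have hlog := (hasLogDeriv_curveLSeries k F p).map (algebraMap ℚ ℂ)
  have hW : PowerSeries.map (algebraMap ℚ ℂ) (PowerSeries.mk fun n =>
      (n : ℚ) * PowerSeries.coeff n (logLSeries k F p)) =
      PowerSeries.mk fun n => if n = 0 then 0 else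
        ∑ c ∈ ((frobFixed p E u).filter (· ∈ frobFixed p E (s * n))).erase 0,
          exponentialSum p ψ (f.map (algebraMap k E)) (s * n) c := by
    ext n
    rw [PowerSeries.coeff_map, PowerSeries.coeff_mk, PowerSeries.coeff_mk]
    split_ifs with hn
    · simp [hn]
    · have : NeZero n := ⟨hn⟩
      rw [natCast_mul_coeff_logLSeries, ← numPoints_sub_eq_sum_exponentialSum hk hu hd hF hψ n, hk]
      push_cast
      rfl
  rw [hW] at hlog
  have heq : (L : PowerSeries ℂ) = PowerSeries.map (algebraMap ℚ ℂ) (curveLSeries k F p) :=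
    h4.unique hlog (by simp) (by
      rw [Polynomial.coeff_coe, h2, PowerSeries.coeff_map, coeff_zero_curveLSeries, map_one])
  have hcoeff : ∀ i, L.coeff i = algebraMap ℚ ℂ (PowerSeries.coeff i (curveLSeries k F p)) :=
    fun i => by rw [← PowerSeries.coeff_map, ← heq, Polynomial.coeff_coe]
  -- The coefficients are algebraic integers and rational, and ℤ is integrally closed.
  have hint : ∀ i, ∃ z : ℤ, (z : ℚ) = PowerSeries.coeff i (curveLSeries k F p) := by
    intro i
    have := h3 i
    rw [hcoeff, isIntegral_algebraMap_iff (algebraMap ℚ ℂ).injective,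
      IsIntegrallyClosed.isIntegral_iff] at this
    simpa using this
  choose z hz using hint
  refine ⟨z, hz, fun i hi => ?_⟩
  have h5 := hcoeff i
  rw [coeff_eq_zero_of_natDegree_lt (h1.trans_lt (by rwa [hdeg])), ← hz, eq_comm,
    map_eq_zero_iff _ (algebraMap ℚ ℂ).injective] at h5
  exact_mod_cast h5

end LSeries

/-! ### First slope of the Newton polygon, and the genus. -/

section NewtonPolygon

/-- The segment from the origin to the `i`-th point lies in the hull. At abscissa `min ε i` it
cannot pass below the first edge, so its slope is at least `m`. -/
theorem mul_le_of_hasFirstSlope {p s N : ℕ} {c : ℕ → ℚ} {m : ℝ}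
    (h : HasFirstSlope (newtonPolygon p s N c) m) {i : ℕ} (hi : 1 ≤ i) (hiN : i ≤ N)
    (hc : c i ≠ 0) : m * i ≤ (padicValRat p (c i) : ℝ) / s := by
  obtain ⟨ε, hε, hNP⟩ := h
  have hi' : (0 : ℝ) < i := by exact_mod_cast hi
  set w : ℝ := (padicValRat p (c i) : ℝ) / s
  set t : ℝ := min ε i
  have ht : 0 < t := lt_min hε hi'
  have h0 := (hNP 0 ⟨le_rfl, hε.le⟩).1
  have h1 : ((i : ℝ), w) ∈ convexHull ℝ (newtonPoints p s N c) :=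
    subset_convexHull ℝ _ ⟨i, hiN, hc, rfl⟩
  have h2 : (t, t / i * w) ∈ convexHull ℝ (newtonPoints p s N c) := by
    have hle : t / i ≤ 1 := (div_le_one hi').2 (min_le_right _ _)
    have := (convex_convexHull ℝ (newtonPoints p s N c)) h0 h1 (sub_nonneg.2 hle)
      (div_nonneg ht.le hi'.le) (sub_add_cancel 1 (t / (i : ℝ)))
    convert this using 1
    simp [div_mul_cancel₀ _ hi'.ne']
  have h3 := (hNP t ⟨ht.le, min_le_left _ _⟩).2 _ h2
  simp only at h3
  rw [div_mul_eq_mul_div, le_div_iff₀ hi', mul_comm m, mul_assoc] at h3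
  exact le_of_mul_le_mul_left h3 ht

/-- The halved product is even: for odd `p` the first factor is even, and for `p = 2` the degree `d`
is odd. -/
theorem two_mul_artinSchreierGenus {p u d : ℕ} (hp : p.Prime) (hd : d.Coprime p) :
    2 * artinSchreierGenus (p ^ u) d = (p ^ u - 1) * (d - 1) := by
  refine Nat.two_mul_div_two_of_even ?_
  rcases hp.eq_two_or_odd' with rfl | hodd
  · exact ((Nat.coprime_two_right.1 hd).tsub_odd odd_one).mul_left _
  · exact ((hodd.pow).tsub_odd odd_one).mul_right _

end NewtonPolygon

/-! ### The two divisibility statements. -/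

theorem proposition1 (p : ℕ) [Fact p.Prime] (u s d : ℕ) (hu : 1 ≤ u)
    {k : Type*} [Field k] [Finite k] [CharP k p] (hk : Nat.card k = p ^ s)
    (f : k[X]) (hd : f.natDegree = d) (hdp : Nat.Coprime d p)
    {F : Type*} [Field F] [Algebra k F] (x y : F)
    (hF : IsFunctionFieldOf k F (p ^ u) f x y)
    (σ : ℝ) (hσ : 2 ≤ σ)
    (hslope : HasFirstSlope
      (newtonPolygon p s (2 * artinSchreierGenus (p ^ u) d)
        (fun i => PowerSeries.coeff i (curveLSeries k F p)))
      (1 / σ)) :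
    (∃ L : ℤ[X], L.natDegree ≤ 2 * artinSchreierGenus (p ^ u) d ∧
        ((L.map (Int.castRingHom ℚ) : ℚ[X]) : PowerSeries ℚ) = curveLSeries k F p ∧
        ∀ i : ℕ, 1 ≤ i → i ≤ 2 * artinSchreierGenus (p ^ u) d →
          (p : ℤ) ^ ⌈((s : ℝ) * (i : ℝ)) / σ⌉₊ ∣ L.coeff i) ∧
      ∀ (n : ℕ) [NeZero n],
        (p : ℤ) ^ ⌈((s : ℝ) * (n : ℝ)) / σ⌉₊ ∣
          |(numPoints k F p n : ℤ) - (((p : ℤ) ^ s) ^ n + 1)| := by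
  have hp : p.Prime := Fact.out
  have hs : s ≠ 0 := by
    rintro rfl
    exact (Finite.one_lt_card (α := k)).ne' hk
  have hs' : (0 : ℝ) < s := by exact_mod_cast Nat.pos_of_ne_zero hs
  have hσ' : 0 < σ := by linarith
  obtain ⟨z, hz, hz0⟩ := exists_int_coeff_curveLSeries hk (by omega : u ≠ 0) (hd ▸ hdp) hF
  rw [hd, ← two_mul_artinSchreierGenus hp hdp] at hz0
  set N := 2 * artinSchreierGenus (p ^ u) d
  -- No upper bound on `i` is imposed, because coefficients beyond `N` vanish; the recursion for
  -- arbitrary `n` needs this.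
  have hdvd : ∀ i : ℕ, 1 ≤ i → (p : ℤ) ^ ⌈((s : ℝ) * (i : ℝ)) / σ⌉₊ ∣ z i := by
    intro i hi
    rcases eq_or_ne (z i) 0 with h0 | h0
    · rw [h0]
      exact dvd_zero _
    have hiN : i ≤ N := not_lt.1 fun h => h0 (hz0 i h)
    have h1 := mul_le_of_hasFirstSlope hslope hi hiN (by
      rw [← hz]
      exact_mod_cast h0)
    rw [← hz, padicValRat.of_int, le_div_iff₀ hs'] at h1
    rw [padicValInt_dvd_iff]
    right
    rw [Nat.ceil_le]
    calc (s : ℝ) * i / σ = 1 / σ * i * s := by ring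
      _ ≤ _ := by exact_mod_cast h1
  constructor
  · let L : ℤ[X] := ∑ i ∈ Finset.range (N + 1), C (z i) * X ^ i
    have hL : ∀ i, L.coeff i = z i := by
      intro i
      simp only [L, finsetSum_coeff, coeff_C_mul_X_pow, Finset.sum_ite_eq, Finset.mem_range]
      split_ifs with h
      · rfl
      · exact (hz0 i (by omega)).symm
    refine ⟨L, ?_, ?_, fun i hi _ => ?_⟩
    · exact natDegree_le_iff_coeff_eq_zero.2 fun i hi => by rw [hL, hz0 i hi]
    · ext i
      rw [Polynomial.coeff_coe, coeff_map, hL, ← hz]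
      rfl
    · rw [hL]
      exact hdvd i hi
  · let W : ℕ → ℤ := fun n => if hn : n = 0 then 0 else
      have : NeZero n := ⟨hn⟩
      (numPoints k F p n : ℤ) - (((p : ℤ) ^ s) ^ n + 1)
    have hW : ∀ n : ℕ, (n : ℚ) * PowerSeries.coeff n (logLSeries k F p) = W n := by
      intro n
      rcases eq_or_ne n 0 with rfl | hn
      · simp [W]
      · have : NeZero n := ⟨hn⟩
        rw [natCast_mul_coeff_logLSeries, hk]
        simp only [W, dif_neg hn]
        push_cast
        ring
    have hrec : ∀ n : ℕ, (n : ℤ) * z n = ∑ a ∈ Finset.HasAntidiagonal.antidiagonal n, z a.1 * W a.2 := by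
      intro n
      have := HasLogDeriv.iff_coeff.1 (hasLogDeriv_curveLSeries k F p) n
      rw [PowerSeries.coeff_mul] at this
      simp only [PowerSeries.coeff_mk, hW, ← hz] at this
      exact_mod_cast this
    have hz1 : z 0 = 1 := by
      have := (hz 0).trans (coeff_zero_curveLSeries k F p)
      exact_mod_cast this
    have key : ∀ n : ℕ, (p : ℤ) ^ ⌈((s : ℝ) * (n : ℝ)) / σ⌉₊ ∣ W n := by
      intro n
      induction n using Nat.strong_induction_on with
      | _ n ih =>
        rcases Nat.eq_zero_or_pos n with rfl | hn
        · simp [W]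
        -- The term z_0 W_n = W_n is isolated; every other term has first index at least 1, so its
        -- `W` has a smaller index.
        have h1 : (0, n) ∈ Finset.HasAntidiagonal.antidiagonal n := by simp
        have h2 := hrec n
        rw [← Finset.add_sum_erase _ _ h1, hz1, one_mul, ← sub_eq_iff_eq_add] at h2
        simp only at h2
        rw [← h2]
        refine dvd_sub (dvd_mul_of_dvd_right (hdvd n hn) _) (Finset.dvd_sum fun a ha => ?_)
        rw [Finset.mem_erase, Finset.HasAntidiagonal.mem_antidiagonal] at ha
        have ha1 : 1 ≤ a.1 := by
          by_contra h
          exact ha.1 (Prod.ext (by omega) (by simp; omega))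
        -- Subadditivity of the ceiling: the two exponents add up to at least the one required for
        -- `n`.
        refine dvd_trans (pow_dvd_pow _ ?_)
          ((pow_add (p : ℤ) _ _).dvd.trans (mul_dvd_mul (hdvd a.1 ha1) (ih a.2 (by omega))))
        rw [← ha.2]
        push_cast
        rw [mul_add, add_div]
        exact Nat.ceil_add_le _ _
    intro n hn
    have := key n
    simp only [W, dif_neg hn.ne] at this
    exact (dvd_abs _ _).2 this
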